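/- Let $\|\cdot\|$ be the Euclidean norm on $\mathbb R^n$ (and the induced operator norm on matrices). **Inner solver (UTR).** For a twice differentiable $h:\mathbb R^n\to\mathbb R$ with $L$-Lipschitz Hessian, the universal trust-region method with the simple strategy generates, from a point $z_0$, iterates $z_0,z_1,\dots$: with $g_i=\nabla h(z_i)$, $H_i=\nabla^2h(z_i)$, $\sigma=\sqrt L/3$, $r=1/(3\sqrt L)$, it computes a solution $s_i$ of $$\min_s\ \tfrac12 s^T\big(H_i+\sigma\|g_i\|^{1/2}I\big)s+g_i^Ts\quad\text{s.t. } \|s\|\le r\|g_i\|^{1/2},$$ and sets $z_{i+1}=z_i+s_i$ if $h(z_i+s_i)\le h(z_i)$, $\|\nabla h(z_i+s_i)\|\le 6\|g_i\|$, and moreover $h(z_i+s_i)-h(z_i)\le-\frac1{81\sqrt L}\|g_i\|^{3/2}$ or $\|\nabla h(z_i+s_i)\|\le\frac16\|g_i\|$; otherwise $z_{i+1}=z_i$ (the iteration is repeated and counted). **Accelerated UTR method.** Given $f$, $M>0$, $x_0\in\mathbb R^n$ and an inner accuracy $\delta>0$, put $v_0=x_0$, $A_0=0$, $d(x)=\frac13\|x-x_0\|^3$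 and $\beta_d(x;y)=d(y)-d(x)-\nabla d(x)^T(y-x)$. For $k=0,1,2,\dots$ set $a_{k+1}=\frac{(k+1)^2}{9M}$, $A_{k+1}=A_k+a_{k+1}$, $$h_{k+1}(y)=A_{k+1}\,f\Big(\frac{a_{k+1}y+A_kx_k}{A_{k+1}}\Big)+\beta_d(v_k;y);$$ run UTR on $h_{k+1}$ from $v_k$ with $L=3$ until, after $T_k$ inner iterations, it finds for the first time a point $v_{k+1}$ with $\|\nabla h_{k+1}(v_{k+1})\|\le\delta$; and set $x_{k+1}=\frac{a_{k+1}v_{k+1}+A_kx_k}{A_{k+1}}$. **Statement.** There are universal constants $c,C>0$ such that the following holds for all $n$, all $M>0$, all convex, twice continuously differentiable $f:\mathbb R^n\to\mathbb R$ with $\|\nabla^2f(x)-\nabla^2f(y)\|\le M\|x-y\|$ for all $x,y$, every minimizer $x^*$ of $f$ (with $f^*=f(x^*)$), every $x_0\in\mathbb R^n$ and every $\varepsilon>0$. The accelerated UTR method with $\delta=c\,(\varepsilon/M)^{2/3}$ can be run from $x_0$ (every subproblem has a solution and every inner loop terminates). For each of its runs, the Hessian of every $h_{k+1}$ is Lipschitz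 continuous with constant $3$, and there is an index $K$ such that $f(x_K)-f^*\le\varepsilon$ and the total number of outer and inner iterations performed up to $x_K$ satisfies $$\sum_{k=0}^{K-1}(1+T_k)\ \le\ C\Big(1+\big(M\beta_d(x_0;x^*)\big)^{1/3}\varepsilon^{-1/3}\Big)\Big(1+\log\Big(1+\frac{M\beta_d(x_0;x^*)}{\varepsilon}\Big)+\log\Big(1+\frac{\|\nabla^2f(x_0)\|^3}{M^2\varepsilon}\Big)\Big).$$ In other words, a point $x$ with $f(x)-f^*\le O(\varepsilon)$ is found within $\tilde O\big((M\beta_d(x_0;x^*))^{1/3}\varepsilon^{-1/3}\big)$ iterations. -/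

import Mathlib

namespace UTR

noncomputable section

/-- Euclidean space `ℝⁿ`. -/
abbrev Vec (n : ℕ) : Type := EuclideanSpace ℝ (Fin n)

/-- The Hessian of `g` at `x`, as a linear operator: the derivative of the gradient. -/
def hess {n : ℕ} (g : Vec n → ℝ) (x : Vec n) : Vec n →L[ℝ] Vec n :=
  fderiv ℝ (gradient g) x

/-- `g` is twice continuously differentiable and its Hessian is Lipschitz continuous with
constant `L` in the operator norm. -/
def HasLipschitzHessian {n : ℕ} (g : Vec n → ℝ) (L : ℝ) : Prop :=
  ContDiff ℝ 2 g ∧ ∀ x y, ‖hess g x - hess g y‖ ≤ L * ‖x - y‖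

/-! ### The universal trust-region method with the simple strategy -/

/-- The gradient-regularized quadratic model
`½ ⟨(H + σ ‖∇g(x)‖^{1/2} I) s, s⟩ + ⟨∇g(x), s⟩` with `H = ∇²g(x)`. -/
def trModel {n : ℕ} (g : Vec n → ℝ) (x : Vec n) (σ : ℝ) (s : Vec n) : ℝ :=
  (1 / 2) * inner ℝ (hess g x s + (σ * √‖gradient g x‖) • s) s + inner ℝ (gradient g x) s

/-- `s` is a (global) solution of the trust-region subproblem: it minimizes the model
over the ball `‖s‖ ≤ r ‖∇g(x)‖^{1/2}`. -/
def SolvesSubproblem {n : ℕ} (g : Vec n → ℝ) (x : Vec n) (σ r : ℝ) (s : Vec n) : Prop :=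
  ‖s‖ ≤ r * √‖gradient g x‖ ∧
    ∀ t : Vec n, ‖t‖ ≤ r * √‖gradient g x‖ → trModel g x σ s ≤ trModel g x σ t

/-- The acceptance test ("the step is good enough"): monotonicity, sufficient decrease of the
value or of the gradient norm, and controlled growth of the gradient norm, with the constants
`κ = 1/81` and `ξ = 1/6` that belong to the simple strategy. -/
def GoodStep {n : ℕ} (g : Vec n → ℝ) (L : ℝ) (x s : Vec n) : Prop :=
  g (x + s) - g x ≤ 0 ∧
  (g (x + s) - g x ≤ -((1 / 81) / √L) * ‖gradient g x‖ ^ (3 / 2 : ℝ) ∨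
    ‖gradient g (x + s)‖ ≤ (1 / 6) * ‖gradient g x‖) ∧
  ‖gradient g (x + s)‖ ≤ 6 * ‖gradient g x‖

/-- `z` is a sequence of iterates of the universal trust-region method applied to `g`, started
at `z₀`, with the simple strategy `(σ, r) = (√L / 3, 1 / (3 √L))`. In every iteration the
subproblem is solved; the step is taken if it passes the test, otherwise the iterate is kept and
the iteration is repeated (and counted). -/
def IsUTRSequence {n : ℕ} (g : Vec n → ℝ) (L : ℝ) (z₀ : Vec n) (z : ℕ → Vec n) : Prop :=
  z 0 = z₀ ∧
  ∀ i, ∃ s, SolvesSubproblem g (z i) (√L / 3) (1 / (3 * √L)) s ∧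
    ((GoodStep g L (z i) s ∧ z (i + 1) = z i + s) ∨
      (¬ GoodStep g L (z i) s ∧ z (i + 1) = z i))

/-! ### The accelerated method -/

/-- The prox function `d(x) = ⅓ ‖x - x₀‖³`. -/
def prox {n : ℕ} (x₀ x : Vec n) : ℝ := (1 / 3) * ‖x - x₀‖ ^ 3

/-- The Bregman divergence `β_d(x; y) = d(y) - d(x) - ⟨∇d(x), y - x⟩` of `d = prox x₀`. -/
def bregman {n : ℕ} (x₀ x y : Vec n) : ℝ :=
  prox x₀ y - prox x₀ x - inner ℝ (gradient (prox x₀) x) (y - x)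

/-- `aCoef M k` is `a_k = k² / (9 M)`. -/
def aCoef (M : ℝ) (k : ℕ) : ℝ := (k : ℝ) ^ 2 / (9 * M)

/-- `ACoef M k` is `A_k`, where `A_0 = 0` and `A_{k+1} = A_k + a_{k+1}`. -/
def ACoef (M : ℝ) : ℕ → ℝ
  | 0 => 0
  | k + 1 => ACoef M k + aCoef M (k + 1)

/-- The contracted point `(a_{k+1} y + A_k x_k) / A_{k+1}`, for `xk = x_k`. -/
def contract {n : ℕ} (M : ℝ) (k : ℕ) (xk y : Vec n) : Vec n :=
  (ACoef M (k + 1))⁻¹ • (aCoef M (k + 1) • y + ACoef M k • xk)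

/-- The auxiliary function
`h_{k+1}(y) = A_{k+1} f((a_{k+1} y + A_k x_k) / A_{k+1}) + β_d(v_k; y)`. -/
def aux {n : ℕ} (f : Vec n → ℝ) (M : ℝ) (x₀ : Vec n) (k : ℕ) (xk vk y : Vec n) : ℝ :=
  ACoef M (k + 1) * f (contract M k xk y) + bregman x₀ vk y

/-- The Lipschitz constant of the Hessian that the inner solver uses for `h_{k+1}`: at most
`M a_{k+1}³ / A_{k+1}² ≤ 1` for the contracted part and `2` for the divergence. -/
def auxLip : ℝ := 3

/-- A run of the accelerated universal trust-region method from `x₀` with inner accuracy `δ`: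
`x`, `v` are the outer sequences, `z k` is the sequence of inner iterates in outer iteration `k`
(started at `v_k`), and `T k` is the number of inner iterations: the first index at which the
gradient norm of `h_{k+1}` is at most `δ`. -/
structure IsAcceleratedRun {n : ℕ} (f : Vec n → ℝ) (M : ℝ) (x₀ : Vec n) (δ : ℝ)
    (x v : ℕ → Vec n) (z : ℕ → ℕ → Vec n) (T : ℕ → ℕ) : Prop where
  x_zero : x 0 = x₀
  v_zero : v 0 = x₀
  inner_run : ∀ k, IsUTRSequence (aux f M x₀ k (x k) (v k)) auxLip (v k) (z k)
  inner_stop : ∀ k, ‖gradient (aux f M x₀ k (x k) (v k)) (z k (T k))‖ ≤ δ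
  inner_first : ∀ k, ∀ i < T k, δ < ‖gradient (aux f M x₀ k (x k) (v k)) (z k i)‖
  v_succ : ∀ k, v (k + 1) = z k (T k)
  x_succ : ∀ k, x (k + 1) = contract M k (x k) (v (k + 1))

end

end UTR

/-! The method is an inexact contracting proximal scheme whose subproblems are uniformly convex of
degree three, the class on which UTR converges linearly. Two estimates carry the proof.

Outer rate. Stationarity of $h_{k+1}$ at $v_{k+1}$ up to $\delta$, convexity of $f$ and the
three-point identity of the Bregman divergence make $A_k(f(x_k)-f^*)+\beta_d(v_k;x^*)$ grow by at
most $\delta\|v_{k+1}-x^*\|$ per step (`energy_le`). Since $\beta_d(v;x^*)\ge\frac16\|v-x^*\|^3$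
(`le_bregman`), the accumulated error is absorbed by the divergence itself, all $v_k$ stay in a
controlled ball (`exists_radius`), and $A_K\ge K^3/(27M)$ gives the rate $K^{-3}$.

Inner cost. The prox term makes $h_{k+1}$ cubically uniformly convex, and $a_{k+1}$ is chosen so
that the contraction scales the Hessian's Lipschitz constant down to at most 1; the prox contributes
2. For convex functions no trial step is rejected (`SolvesSubproblem.goodStep`), and uniform
convexity bounds the value gap by $\|\nabla h\|^{3/2}$, the order of the guaranteed decrease. A
potential mixing value gap and gradient norm then halves at every iteration
(`exists_inner_iteration_bound`), so the inner count is logarithmic in $\|\nabla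
h_{k+1}(v_k)\|/\delta$. At $v_k$ the prox part of this gradient vanishes, and the rest is polynomial
in the scaled distance $t$ and the scaled Hessian norm $\eta$. -/

namespace UTR

open Set

variable {n : ℕ}

/-! ### Second-order calculus of functions on Euclidean space -/

theorem contDiff_gradient {h : Vec n → ℝ} (hh : ContDiff ℝ 2 h) : ContDiff ℝ 1 (gradient h) := by
  have h1 : ContDiff ℝ 1 (fderiv ℝ h) := hh.fderiv_right (by norm_num)
  exact (InnerProductSpace.toDual ℝ (Vec n)).symm.contDiff.comp h1

theorem hasFDerivAt_gradient {h : Vec n → ℝ} (hh : ContDiff ℝ 2 h) (x : Vec n) :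
    HasFDerivAt (gradient h) (hess h x) x :=
  ((contDiff_gradient hh).differentiable (by norm_num) x).hasFDerivAt

theorem hasGradientAt_of_contDiff {h : Vec n → ℝ} (hh : ContDiff ℝ 2 h) (x : Vec n) :
    HasGradientAt h (gradient h x) x :=
  (hh.differentiable (by norm_num) x).hasGradientAt

/-- A function with a continuously differentiable gradient is twice continuously
differentiable. -/
theorem contDiff_two_of_hasGradientAt {h : Vec n → ℝ} {G : Vec n → Vec n}
    (hG : ∀ x, HasGradientAt h (G x) x) (hC : ContDiff ℝ 1 G) : ContDiff ℝ 2 h := by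
  have key : fderiv ℝ h = fun x => InnerProductSpace.toDual ℝ (Vec n) (G x) := by
    funext x
    exact (hG x).hasFDerivAt.fderiv
  have : ContDiff ℝ (1 + 1) h := by
    rw [contDiff_succ_iff_fderiv]
    refine ⟨fun x => (hG x).differentiableAt, by simp, ?_⟩
    rw [key]
    exact (InnerProductSpace.toDual ℝ (Vec n)).contDiff.comp hC
  exact this

theorem inner_hess_comm {h : Vec n → ℝ} (hh : ContDiff ℝ 2 h) (x s t : Vec n) :
    inner ℝ (hess h x s) t = inner ℝ (hess h x t) s := by
  have hs := (hh.contDiffAt (x := x)).isSymmSndFDerivAt (by simp)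
  have h1 : ∀ u v, fderiv ℝ (fderiv ℝ h) x u v = inner ℝ (hess h x u) v := by
    intro u v
    have e : (fun y => inner ℝ (gradient h y) v) = fun y => fderiv ℝ h y v := by
      funext y; exact inner_gradient_left
    have d1 := (hasFDerivAt_gradient hh x).inner ℝ (hasFDerivAt_const v x)
    have d2 := (((hh.fderiv_right (m := 1) (by norm_num)).differentiable (by norm_num)
      x).hasFDerivAt).clm_apply (hasFDerivAt_const v x)
    rw [e] at d1
    have := congrArg (fun F => F u) (d1.unique d2)
    simpa using this.symm
  rw [← h1, ← h1, hs s t]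

theorem hasDerivAt_line (x s : Vec n) (t : ℝ) : HasDerivAt (fun t : ℝ => x + t • s) s t := by
  simpa using ((hasDerivAt_id t).smul_const s).const_add x

theorem hasDerivAt_comp_line {h : Vec n → ℝ} (hh : ContDiff ℝ 2 h) (x s : Vec n) (t : ℝ) :
    HasDerivAt (fun t : ℝ => h (x + t • s)) (inner ℝ (gradient h (x + t • s)) s) t := by
  have := (hasGradientAt_of_contDiff hh (x + t • s)).hasFDerivAt.comp_hasDerivAt t
    (hasDerivAt_line x s t)
  simpa [Function.comp_def] using this

theorem hasDerivAt_gradient_comp_line {h : Vec n → ℝ} (hh : ContDiff ℝ 2 h) (x s : Vec n)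
    (t : ℝ) :
    HasDerivAt (fun t : ℝ => gradient h (x + t • s)) (hess h (x + t • s) s) t :=
  HasFDerivAt.comp_hasDerivAt (l := gradient h) (f := fun t : ℝ => x + t • s) t
    (hasFDerivAt_gradient hh (x + t • s)) (hasDerivAt_line x s t)

theorem norm_gradient_line_sub_le {h : Vec n → ℝ} {L : ℝ} (hh : HasLipschitzHessian h L)
    (x s : Vec n) {t : ℝ} (ht : t ∈ Icc (0 : ℝ) 1) :
    ‖gradient h (x + t • s) - gradient h x - t • hess h x s‖ ≤ L / 2 * ‖s‖ ^ 2 * t ^ 2 := by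
  have hd : ∀ u : ℝ, HasDerivAt
      (fun t : ℝ => gradient h (x + t • s) - gradient h x - t • hess h x s)
      (hess h (x + u • s) s - hess h x s) u := by
    intro u
    exact (((hasDerivAt_gradient_comp_line hh.1 x s u).sub_const (gradient h x)).sub
      ((hasDerivAt_id u).smul_const (hess h x s))).congr_deriv (by simp)
  refine image_norm_le_of_norm_deriv_right_le_deriv_boundary (a := 0) (b := 1)
    (B := fun t => L / 2 * ‖s‖ ^ 2 * t ^ 2) (B' := fun t => L * ‖s‖ ^ 2 * t)
    (fun u _ => (hd u).continuousAt.continuousWithinAt)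
    (fun u _ => (hd u).hasDerivWithinAt) (by simp) ?_ ?_ ht
  · intro u
    exact (((hasDerivAt_id u).pow 2).const_mul (L / 2 * ‖s‖ ^ 2)).congr_deriv (by simp; ring)
  · intro u hu
    rw [← sub_apply]
    calc _ ≤ ‖hess h (x + u • s) - hess h x‖ * ‖s‖ := ContinuousLinearMap.le_opNorm _ _
      _ ≤ (L * ‖x + u • s - x‖) * ‖s‖ := by gcongr; exact hh.2 _ _
      _ = L * ‖s‖ ^ 2 * u := by
        rw [add_sub_cancel_left, norm_smul, Real.norm_of_nonneg hu.1]; ring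

theorem norm_gradient_add_sub_le {h : Vec n → ℝ} {L : ℝ} (hh : HasLipschitzHessian h L)
    (x s : Vec n) :
    ‖gradient h (x + s) - gradient h x - hess h x s‖ ≤ L / 2 * ‖s‖ ^ 2 := by
  simpa using norm_gradient_line_sub_le hh x s (t := 1) (by simp)

theorem abs_sub_quadratic_le {h : Vec n → ℝ} {L : ℝ} (hh : HasLipschitzHessian h L)
    (x s : Vec n) :
    |h (x + s) - h x - inner ℝ (gradient h x) s - 1 / 2 * inner ℝ (hess h x s) s|
      ≤ L / 6 * ‖s‖ ^ 3 := by
  have hd : ∀ u : ℝ, HasDerivAt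
      (fun t : ℝ => h (x + t • s) - h x - t * inner ℝ (gradient h x) s
        - t ^ 2 * (1 / 2 * inner ℝ (hess h x s) s))
      (inner ℝ (gradient h (x + u • s) - gradient h x - u • hess h x s) s) u := by
    intro u
    refine ((((hasDerivAt_comp_line hh.1 x s u).sub_const (h x)).sub
      ((hasDerivAt_id u).mul_const (inner ℝ (gradient h x) s))).sub
      (((hasDerivAt_id u).pow 2).mul_const (1 / 2 * inner ℝ (hess h x s) s))).congr_deriv ?_
    simp only [inner_sub_left, real_inner_smul_left, id]
    push_cast; ring
  have := image_norm_le_of_norm_deriv_right_le_deriv_boundary (a := 0) (b := 1)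
    (B := fun t => L / 6 * ‖s‖ ^ 3 * t ^ 3) (B' := fun t => L / 2 * ‖s‖ ^ 3 * t ^ 2)
    (fun u _ => (hd u).continuousAt.continuousWithinAt)
    (fun u _ => (hd u).hasDerivWithinAt) (by simp) ?_ ?_ (right_mem_Icc.2 zero_le_one)
  · simpa using this
  · intro u
    exact (((hasDerivAt_id u).pow 3).const_mul (L / 6 * ‖s‖ ^ 3)).congr_deriv (by simp; ring)
  · intro u hu
    calc _ ≤ ‖gradient h (x + u • s) - gradient h x - u • hess h x s‖ * ‖s‖ :=
          norm_inner_le_norm _ _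
      _ ≤ (L / 2 * ‖s‖ ^ 2 * u ^ 2) * ‖s‖ := by
          gcongr; exact norm_gradient_line_sub_le hh x s ⟨hu.1, hu.2.le⟩
      _ = _ := by ring

theorem gradient_inequality {f : Vec n → ℝ} (hf : ContDiff ℝ 2 f)
    (hc : ConvexOn ℝ univ f) (x y : Vec n) :
    f x + inner ℝ (gradient f x) (y - x) ≤ f y := by
  have hcl : ConvexOn ℝ univ (f ∘ (AffineMap.lineMap x y : ℝ →ᵃ[ℝ] Vec n)) := by
    simpa using hc.comp_affineMap (AffineMap.lineMap x y : ℝ →ᵃ[ℝ] Vec n)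
  have e : (f ∘ (AffineMap.lineMap x y : ℝ →ᵃ[ℝ] Vec n)) = fun t : ℝ => f (x + t • (y - x)) := by
    funext t
    simp [AffineMap.lineMap_apply, add_comm]
  rw [e] at hcl
  have := hcl.le_slope_of_hasDerivAt (mem_univ 0) (mem_univ 1) one_pos
    (hasDerivAt_comp_line hf x (y - x) 0)
  simp only [slope, sub_zero, inv_one, zero_smul, one_smul, add_zero, vsub_eq_sub, smul_eq_mul,
    one_mul, add_sub_cancel] at this
  linarith

/-- Passage to the limit $\tau\to0$, used to discard the higher-order term in directional arguments.
-/
theorem nonneg_of_forall_nonneg_add_mul {a b : ℝ}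
    (h : ∀ τ : ℝ, 0 < τ → τ ≤ 1 → 0 ≤ a + τ * b) : 0 ≤ a := by
  by_contra ha
  push Not at ha
  have hb : 0 < 2 * (|b| + 1) := by positivity
  have hτ : 0 < min 1 (-a / (2 * (|b| + 1))) := lt_min one_pos (div_pos (by linarith) hb)
  have h1 := h _ hτ (min_le_left _ _)
  have h2 : min 1 (-a / (2 * (|b| + 1))) * (2 * (|b| + 1)) ≤ -a :=
    (le_div_iff₀ hb).1 (min_le_right _ _)
  have h3 := mul_le_mul_of_nonneg_left (le_abs_self b) hτ.le
  nlinarith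

theorem inner_hess_nonneg {h : Vec n → ℝ} {L : ℝ} (hh : HasLipschitzHessian h L)
    (hconv : ∀ x y, h x + inner ℝ (gradient h x) (y - x) ≤ h y) (x s : Vec n) :
    0 ≤ inner ℝ (hess h x s) s := by
  have key : 0 ≤ 1 / 2 * inner ℝ (hess h x s) s := by
    -- Taylor at $x+\tau s$ against the gradient inequality; after division by $\tau^2$ only the
    -- cubic remainder carries a factor $\tau$.
    refine nonneg_of_forall_nonneg_add_mul (b := L / 6 * ‖s‖ ^ 3) fun τ hτ _ => ?_
    have h1 := (abs_le.1 (abs_sub_quadratic_le hh x (τ • s))).2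
    have h2 := hconv x (x + τ • s)
    rw [add_sub_cancel_left] at h2
    rw [map_smul, real_inner_smul_left, real_inner_smul_right (hess h x s), norm_smul,
      Real.norm_of_nonneg hτ.le] at h1
    have h3 : 0 ≤ τ ^ 2 * (1 / 2 * inner ℝ (hess h x s) s + τ * (L / 6 * ‖s‖ ^ 3)) := by
      nlinarith
    exact (mul_nonneg_iff_of_pos_left (by positivity)).1 h3
  linarith

/-! ### The trust-region subproblem -/

theorem exists_solvesSubproblem (g : Vec n → ℝ) (x : Vec n) (σ : ℝ) {r : ℝ} (hr : 0 ≤ r) :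
    ∃ s, SolvesSubproblem g x σ r s := by
  have hc : Continuous (trModel g x σ) := by
    unfold trModel
    fun_prop
  obtain ⟨s, hs, hmin⟩ := (isCompact_closedBall (0 : Vec n) (r * √‖gradient g x‖)).exists_isMinOn
    ⟨0, by simpa using by positivity⟩ hc.continuousOn
  refine ⟨s, by simpa using hs, fun t ht => hmin (by simpa using ht)⟩

theorem exists_isUTRSequence (g : Vec n → ℝ) (L : ℝ) (z₀ : Vec n) :
    ∃ z, IsUTRSequence g L z₀ z := by
  classical
  choose S hS using fun x => exists_solvesSubproblem g x (√L / 3) (r := 1 / (3 * √L))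
    (by positivity)
  let z : ℕ → Vec n := fun i =>
    Nat.rec z₀ (fun _ x => if GoodStep g L x (S x) then x + S x else x) i
  refine ⟨z, rfl, fun i => ⟨S (z i), hS _, ?_⟩⟩
  have hz : z (i + 1) = if GoodStep g L (z i) (S (z i)) then z i + S (z i) else z i := rfl
  by_cases hg : GoodStep g L (z i) (S (z i))
  · exact Or.inl ⟨hg, by rw [hz, if_pos hg]⟩
  · exact Or.inr ⟨hg, by rw [hz, if_neg hg]⟩

/-- First-order optimality of a solution of the trust-region subproblem. -/
theorem SolvesSubproblem.variational {g : Vec n → ℝ} (hg : ContDiff ℝ 2 g) {x : Vec n}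
    {σ r : ℝ} {s : Vec n} (hs : SolvesSubproblem g x σ r s) {t : Vec n}
    (ht : ‖t‖ ≤ r * √‖gradient g x‖) :
    0 ≤ inner ℝ (hess g x s + (σ * √‖gradient g x‖) • s + gradient g x) (t - s) := by
  set q := √‖gradient g x‖
  refine nonneg_of_forall_nonneg_add_mul
    (b := 1 / 2 * inner ℝ (hess g x (t - s) + (σ * q) • (t - s)) (t - s)) fun τ h0 h1 => ?_
  have hfeas : ‖s + τ • (t - s)‖ ≤ r * q := by
    have hcvx := convex_closedBall (0 : Vec n) (r * q)
    have := hcvx.add_smul_sub_mem (x := s) (y := t) (by simpa using hs.1) (by simpa using ht)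
      ⟨h0.le, h1⟩
    simpa using this
  have hm := hs.2 _ hfeas
  have hsym := inner_hess_comm hg x s (t - s)
  have hc := real_inner_comm s (t - s)
  set d := t - s
  unfold trModel at hm
  simp only [map_add, map_smul, inner_add_left, inner_add_right, real_inner_smul_left,
    real_inner_smul_right, smul_add] at hm ⊢
  have h3 : 0 ≤ τ * (inner ℝ (hess g x s) d + σ * q * inner ℝ s d + inner ℝ (gradient g x) d
      + τ * (1 / 2 * (inner ℝ (hess g x d) d + σ * q * inner ℝ d d))) := by
    change _ ≤ 1 / 2 * (_ + _) + (_ + _) at hm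
    rw [hc] at hm
    rw [← hsym] at hm
    linarith
  exact (mul_nonneg_iff_of_pos_left h0).1 h3

/-- With the simple strategy every trial step for a convex function with `L`-Lipschitz Hessian
passes the acceptance test. -/
theorem SolvesSubproblem.goodStep {h : Vec n → ℝ} {L : ℝ} (hL : 0 < L)
    (hh : HasLipschitzHessian h L)
    (hconv : ∀ x y, h x + inner ℝ (gradient h x) (y - x) ≤ h y) {x s : Vec n}
    (hs : SolvesSubproblem h x (√L / 3) (1 / (3 * √L)) s) : GoodStep h L x s := by
  have hpsd := inner_hess_nonneg hh hconv x s
  have hfeas := hs.1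
  have htaylor := (abs_le.1 (abs_sub_quadratic_le hh x s)).2
  have hgrad := norm_gradient_add_sub_le hh x s
  have hvar := fun t ht => hs.variational hh.1 (t := t) ht
  set g := gradient h x
  set H := hess h x
  -- Writing $L=l^2$ and $\|g\|=q^2$ turns every estimate below into a polynomial inequality.
  obtain ⟨l, hl, rfl⟩ : ∃ l : ℝ, 0 < l ∧ L = l ^ 2 :=
    ⟨√L, Real.sqrt_pos.2 hL, (Real.sq_sqrt hL.le).symm⟩
  obtain ⟨q, hq, hG⟩ : ∃ q : ℝ, 0 ≤ q ∧ ‖g‖ = q ^ 2 :=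
    ⟨√‖g‖, Real.sqrt_nonneg _, (Real.sq_sqrt (norm_nonneg _)).symm⟩
  have hpow : ‖g‖ ^ (3 / 2 : ℝ) = q ^ 3 := by
    rw [hG, ← Real.rpow_natCast, ← Real.rpow_mul hq]; norm_num
  unfold GoodStep
  rw [show gradient h x = g from rfl, hpow, hG]
  rw [hG] at hfeas hvar
  rw [Real.sqrt_sq hq] at hfeas hvar
  rw [Real.sqrt_sq hl.le] at *
  have hfeas' : 3 * l * ‖s‖ ≤ q := by
    rw [one_div, ← div_eq_inv_mul, le_div_iff₀ (by positivity)] at hfeas; linarith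
  -- The gradient of the model at $s$; optimality says $\langle w,t-s\rangle\ge0$ for all feasible
  -- $t$.
  set w := H s + (l / 3 * q) • s + g
  have hν := norm_nonneg s
  -- Testing with $t=0$ gains $\frac13$ from the regularization; the Taylor remainder costs
  -- $\frac1{18}$ because $3l\|s\|\le q$.
  have hdec : h (x + s) - h x ≤ -(5 / 18 * l * q * ‖s‖ ^ 2) := by
    have h0 := hvar 0 (by simpa using by positivity)
    simp only [w, zero_sub, inner_neg_right, inner_add_left, real_inner_smul_left,
      real_inner_self_eq_norm_sq] at h0
    have h1 : l * ‖s‖ ^ 2 * (3 * l * ‖s‖) ≤ l * ‖s‖ ^ 2 * q := by gcongr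
    nlinarith
  -- Test point: the vector of length $\|s\|$ opposite to $w$. Hence $w$ and $s$ are antiparallel.
  have hw : inner ℝ w s ≤ -(‖s‖ * ‖w‖) := by
    by_cases h0 : w = 0
    · simp [h0]
    have hwp : 0 < ‖w‖ := norm_pos_iff.2 h0
    have := hvar (-(‖s‖ / ‖w‖) • w) (by
      rw [norm_smul, norm_neg, Real.norm_of_nonneg (by positivity)]
      rwa [div_mul_cancel₀ _ hwp.ne'])
    rw [inner_sub_right, real_inner_smul_right, real_inner_self_eq_norm_sq] at this
    have e : -(‖s‖ / ‖w‖) * ‖w‖ ^ 2 = -(‖s‖ * ‖w‖) := by field_simp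
    linarith
  have hnorm_sub : ‖(l / 3 * q) • s‖ = l / 3 * q * ‖s‖ := by
    rw [norm_smul, Real.norm_of_nonneg (by positivity)]
  have hsmall : l / 3 * q * ‖s‖ ≤ q ^ 2 / 9 := by nlinarith
  have hquad : l ^ 2 / 2 * ‖s‖ ^ 2 ≤ q ^ 2 / 18 := by
    have : (3 * l * ‖s‖) ^ 2 ≤ q ^ 2 := by gcongr
    linarith
  have hgnext : ‖gradient h (x + s)‖ ≤ q ^ 2 / 18 + (q ^ 2 / 9 + ‖w‖) := by
    have e : gradient h (x + s) = (gradient h (x + s) - g - H s) + (w - (l / 3 * q) • s) := by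
      simp only [w]; abel
    rw [e]
    refine (norm_add_le _ _).trans ?_
    have := norm_sub_le w ((l / 3 * q) • s)
    linarith
  have hwle : ‖w‖ ≤ q ^ 2 := by
    by_cases h0 : s = 0
    · simp [w, h0, hG]
    have hsp : 0 < ‖s‖ := norm_pos_iff.2 h0
    have h1 : inner ℝ w s = inner ℝ (H s) s + l / 3 * q * ‖s‖ ^ 2 + inner ℝ g s := by
      simp only [w, inner_add_left, real_inner_smul_left, real_inner_self_eq_norm_sq]
    have h2 := (abs_le.1 (abs_real_inner_le_norm g s)).1
    rw [hG] at h2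
    have h3 : 0 ≤ l / 3 * q * ‖s‖ ^ 2 := by positivity
    have h4 : ‖s‖ * ‖w‖ ≤ ‖s‖ * q ^ 2 := by linarith
    exact le_of_mul_le_mul_left h4 hsp
  refine ⟨hdec.trans (by simp only [Left.neg_nonpos_iff]; positivity), ?_, by nlinarith⟩
  -- Interior solution: $w=0$, and the gradient shrinks to $\frac1{18}+\frac19=\frac16$ of its norm.
  -- Boundary solution: the step is long, so the value drops.
  rcases hfeas'.lt_or_eq with hlt | heq
  · right
    have hw0 : ‖w‖ = 0 := by
      have hρ : ‖s‖ < 1 / (3 * l) * q := by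
        rw [one_div, ← div_eq_inv_mul, lt_div_iff₀ (by positivity)]; linarith
      by_contra hne
      have hwp : 0 < ‖w‖ := lt_of_le_of_ne (norm_nonneg _) (Ne.symm hne)
      have := hvar (-(1 / (3 * l) * q / ‖w‖) • w) (by
        rw [norm_smul, norm_neg, Real.norm_of_nonneg (by positivity)]
        rw [div_mul_cancel₀ _ hwp.ne'])
      rw [inner_sub_right, real_inner_smul_right, real_inner_self_eq_norm_sq] at this
      have e : -(1 / (3 * l) * q / ‖w‖) * ‖w‖ ^ 2 = -(1 / (3 * l) * q * ‖w‖) := by field_simp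
      have h2 := (abs_le.1 (abs_real_inner_le_norm w s)).1
      nlinarith
    linarith
  · left
    refine hdec.trans ?_
    have : l * ‖s‖ ^ 2 = q ^ 2 / (9 * l) := by
      rw [← heq]; field_simp; norm_num
    have e : -(5 / 18 * l * q * ‖s‖ ^ 2) = -(5 / 162 * (q ^ 3 / l)) := by
      rw [show 5 / 18 * l * q * ‖s‖ ^ 2 = 5 / 18 * q * (l * ‖s‖ ^ 2) by ring, this]
      field_simp; ring
    rw [e, show -(1 / 81 / l) * q ^ 3 = -(1 / 81 * (q ^ 3 / l)) by ring]
    have : 0 ≤ q ^ 3 / l := by positivity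
    linarith

/-! ### Complexity of the universal trust-region method on uniformly convex functions -/

theorem rpow_three_halves {a : ℝ} (ha : 0 ≤ a) : a ^ (3 / 2 : ℝ) = √a ^ 3 := by
  rw [Real.sqrt_eq_rpow, ← Real.rpow_natCast, ← Real.rpow_mul ha]
  norm_num

/-- The first-order form of uniform convexity of degree three, with the modulus of the cubic prox
function. -/
def IsCubicallyConvex (h : Vec n → ℝ) : Prop :=
  ∀ x y, h x + inner ℝ (gradient h x) (y - x) + 1 / 6 * ‖y - x‖ ^ 3 ≤ h y

theorem IsCubicallyConvex.convex {h : Vec n → ℝ} (hu : IsCubicallyConvex h) (x y : Vec n) :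
    h x + inner ℝ (gradient h x) (y - x) ≤ h y := by
  have := hu x y
  have : 0 ≤ 1 / 6 * ‖y - x‖ ^ 3 := by positivity
  linarith

/-- Maximize $\|g\|t-\frac16t^3$ over $t=\|y-x\|$: the maximum is $\frac{2\sqrt2}3\|g\|^{3/2}$. -/
theorem IsCubicallyConvex.sub_le {h : Vec n → ℝ} (hu : IsCubicallyConvex h) (x y : Vec n) :
    h x - h y ≤ √‖gradient h x‖ ^ 3 := by
  have h1 := hu x y
  have h2 := (abs_le.1 (abs_real_inner_le_norm (gradient h x) (y - x))).1
  have hq := Real.sqrt_nonneg ‖gradient h x‖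
  rw [← Real.sq_sqrt (norm_nonneg (gradient h x))] at h2
  set q := √‖gradient h x‖
  have ht := norm_nonneg (y - x)
  set t := ‖y - x‖
  -- The maximizer is $\sqrt2\,q$; $\frac{17}{12}$ is a rational substitute close enough to keep the
  -- constant below 1.
  have h3 : 0 ≤ (t - 17 / 12 * q) ^ 2 * (t + 2 * (17 / 12 * q)) := by positivity
  have h4 : 0 ≤ q ^ 2 * t := by positivity
  have h5 : 0 ≤ q ^ 3 := by positivity
  nlinarith

theorem IsUTRSequence.exists_goodStep {h : Vec n → ℝ} {L : ℝ} (hL : 0 < L)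
    (hh : HasLipschitzHessian h L)
    (hconv : ∀ x y, h x + inner ℝ (gradient h x) (y - x) ≤ h y) {z₀ : Vec n} {z : ℕ → Vec n}
    (hz : IsUTRSequence h L z₀ z) (i : ℕ) : ∃ s, GoodStep h L (z i) s ∧ z (i + 1) = z i + s := by
  obtain ⟨s, hs, hcase⟩ := hz.2 i
  have hg := hs.goodStep hL hh hconv
  exact ⟨s, hg, (hcase.resolve_right fun h' => h'.1 hg).2⟩

/-- Neither quantity need contract alone: a value step may enlarge the gradient sixfold, and a
gradient step may leave the value gap unchanged. Since $\Delta+d^3\le2G^{3/2}$, a value step shrinks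
$\Delta+d^3$ by $1-\kappa/2$, and the power $m$ makes this outweigh the factor 6. -/
theorem potential_decrease {κ Δ Δ' G G' d : ℝ} {m : ℕ} (hκ0 : 0 < κ)
    (hm : (1 - κ / 2) ^ m ≤ 1 / 12)
    (hΔ' : 0 ≤ Δ') (hmono : Δ' ≤ Δ) (hd : 0 ≤ d) (hdG : d ≤ √G) (hG0 : 0 ≤ G) (hG'0 : 0 ≤ G')
    (hΔG : Δ ≤ √G ^ 3) (hG' : G' ≤ 6 * G)
    (hstep : Δ' - Δ ≤ -κ * √G ^ 3 ∨ G' ≤ 1 / 6 * G) :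
    2 * ((Δ' + d ^ 3) ^ m * G') ≤ (Δ + d ^ 3) ^ m * G := by
  have hd3 : 0 ≤ d ^ 3 := by positivity
  have hA : 0 ≤ (Δ + d ^ 3) ^ m := pow_nonneg (by linarith) _
  have hW : 0 ≤ (Δ + d ^ 3) ^ m * G := mul_nonneg hA hG0
  rcases hstep with hs | hs
  · have hdG3 : d ^ 3 ≤ √G ^ 3 := by gcongr
    have h1 : Δ' + d ^ 3 ≤ (1 - κ / 2) * (Δ + d ^ 3) := by nlinarith
    have h2 : (Δ' + d ^ 3) ^ m ≤ 1 / 12 * (Δ + d ^ 3) ^ m := by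
      calc _ ≤ ((1 - κ / 2) * (Δ + d ^ 3)) ^ m := pow_le_pow_left₀ (by linarith) h1 m
        _ = (1 - κ / 2) ^ m * (Δ + d ^ 3) ^ m := mul_pow _ _ _
        _ ≤ _ := by gcongr
    calc _ ≤ 2 * ((1 / 12 * (Δ + d ^ 3) ^ m) * (6 * G)) := by gcongr
      _ = _ := by ring
  · calc _ ≤ 2 * ((Δ + d ^ 3) ^ m * (1 / 6 * G)) := by gcongr
      _ = 1 / 3 * ((Δ + d ^ 3) ^ m * G) := by ring
      _ ≤ _ := by linarith

/-- Stated for any initial stretch of large gradients, so that it yields both termination and the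
iteration count. -/
theorem exists_inner_iteration_bound : ∃ C : ℝ, 0 < C ∧ ∀ (n : ℕ) (h : Vec n → ℝ) (z₀ : Vec n)
    (z : ℕ → Vec n) (δ : ℝ), 0 < δ → HasLipschitzHessian h auxLip → IsCubicallyConvex h →
    IsUTRSequence h auxLip z₀ z → ∀ N : ℕ, (∀ i ≤ N, δ < ‖gradient h (z i)‖) →
      (N : ℝ) ≤ C * (1 + Real.log (‖gradient h z₀‖ / δ)) := by
  have hL : (0 : ℝ) < auxLip := by norm_num [auxLip]
  set κ : ℝ := (1 / 81) / √auxLip with hκ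
  have hsq : 1 ≤ √auxLip := Real.one_le_sqrt.2 (by norm_num [auxLip])
  have hκ0 : 0 < κ := by positivity
  have hκ1 : κ ≤ 1 := by
    rw [hκ, div_le_one (by positivity)]; linarith
  obtain ⟨m, hm⟩ := exists_pow_lt_of_lt_one (show (0 : ℝ) < 1 / 12 by norm_num)
    (show 1 - κ / 2 < 1 by linarith)
  have hlog2 : 0 < Real.log 2 := Real.log_pos (by norm_num)
  refine ⟨(m + (3 * m + 2) / Real.log 2), by positivity, ?_⟩
  intro n h z₀ z δ hδ hh hu hz N hN
  have hmono : ∀ i, h (z (i + 1)) ≤ h (z i) := fun i => by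
    obtain ⟨s, hg, he⟩ := hz.exists_goodStep hL hh hu.convex i
    rw [he]; linarith [hg.1]
  have hanti : Antitone fun i => h (z i) := antitone_nat_of_succ_le hmono
  set d := √δ with hd
  have hd0 : 0 < d := Real.sqrt_pos.2 hδ
  -- The gap is measured against the last iterate, so no minimizer of $h$ is needed; the shift
  -- $d^3=\delta^{3/2}$ keeps $W_N$ at least $d^{3m+2}$.
  set W : ℕ → ℝ := fun i => (h (z i) - h (z N) + d ^ 3) ^ m * ‖gradient h (z i)‖ with hW
  have hind : ∀ i ≤ N, 2 ^ i * W i ≤ W 0 := by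
    intro i
    induction i with
    | zero => simp
    | succ i ih =>
      intro hi
      refine le_trans ?_ (ih (by omega))
      have : 2 * W (i + 1) ≤ W i := by
        obtain ⟨s, hg, he⟩ := hz.exists_goodStep hL hh hu.convex i
        refine potential_decrease hκ0 hm.le (sub_nonneg.2 (hanti hi))
          (by linarith [hmono i]) hd0.le (Real.sqrt_le_sqrt (hN i (by omega)).le) (norm_nonneg _)
          (norm_nonneg _) (hu.sub_le _ _) (by rw [he]; exact hg.2.2) ?_
        rw [he]
        refine hg.2.1.imp (fun h' => ?_) id
        rw [rpow_three_halves (norm_nonneg _)] at h'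
        linarith
      rw [pow_succ, mul_assoc]
      gcongr
  set q := √‖gradient h z₀‖ with hq
  have h00 : z 0 = z₀ := hz.1
  have hdq : d ≤ q := by
    have := hN 0 (Nat.zero_le _)
    rw [h00] at this
    exact Real.sqrt_le_sqrt this.le
  have hq0 : 0 < q := hd0.trans_le hdq
  have hqq : ‖gradient h z₀‖ = q ^ 2 := (Real.sq_sqrt (norm_nonneg _)).symm
  have hdd : δ = d ^ 2 := (Real.sq_sqrt hδ.le).symm
  have hW0 : W 0 ≤ 2 ^ m * q ^ (3 * m + 2) := by
    simp only [hW, h00, hqq]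
    have h1 := hu.sub_le z₀ (z N)
    have h2 : d ^ 3 ≤ q ^ 3 := by gcongr
    have h3 : 0 ≤ h z₀ - h (z N) := by
      have := hanti (Nat.zero_le N); simp only [h00] at this; linarith
    have h4 : 0 ≤ d ^ 3 := by positivity
    calc _ ≤ (2 * q ^ 3) ^ m * q ^ 2 := by gcongr; linarith
      _ = _ := by rw [mul_pow, ← pow_mul, pow_add]; ring
  have hWN : d ^ (3 * m + 2) ≤ W N := by
    simp only [hW, sub_self, zero_add]
    rw [pow_add, pow_mul, ← hdd]
    gcongr
    exact (hN N le_rfl).le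
  have hmain : 2 ^ N * d ^ (3 * m + 2) ≤ 2 ^ m * q ^ (3 * m + 2) :=
    le_trans (by gcongr) ((hind N le_rfl).trans hW0)
  have hl := Real.log_le_log (by positivity) hmain
  rw [Real.log_mul (by positivity) (by positivity), Real.log_mul (by positivity) (by positivity),
    Real.log_pow, Real.log_pow, Real.log_pow, Real.log_pow] at hl
  rw [hqq, hdd, ← div_pow, Real.log_pow, Real.log_div hq0.ne' hd0.ne']
  have hlq : 0 ≤ Real.log q - Real.log d := sub_nonneg.2 (Real.log_le_log hd0 hdq)
  push_cast at hl ⊢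
  set l2 := Real.log 2
  set y := Real.log q - Real.log d
  have h5 : (N : ℝ) * l2 ≤ m * l2 + (3 * m + 2) * y := by
    have : (3 * (m : ℝ) + 2) * y = (3 * m + 2) * Real.log q - (3 * m + 2) * Real.log d := by
      simp only [y]; ring
    linarith
  have h6 : (N : ℝ) ≤ m + (3 * m + 2) / l2 * y := by
    rw [show (m : ℝ) + (3 * m + 2) / l2 * y = (m * l2 + (3 * m + 2) * y) / l2 by field_simp,
      le_div_iff₀ hlog2]
    exact h5
  have h7 : 0 ≤ (3 * (m : ℝ) + 2) / l2 := by positivity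
  have h8 : 0 ≤ (m : ℝ) * y := by positivity
  have h9 : 0 ≤ (3 * (m : ℝ) + 2) / l2 * y := by positivity
  nlinarith

/-! ### The cubic prox function -/

/-- Polarization: with $y$ parallel to $Tx$ and $\|y\|=\|x\|$, compare the quadratic form at $x\pm
y$ and apply the parallelogram law. -/
theorem norm_le_of_forall_abs_inner_le {T : Vec n →L[ℝ] Vec n} {c : ℝ} (hc : 0 ≤ c)
    (hsymm : ∀ x y, inner ℝ (T x) y = inner ℝ (T y) x)
    (h : ∀ x, ‖x‖ = 1 → |inner ℝ (T x) x| ≤ c) : ‖T‖ ≤ c := by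
  have hq : ∀ x, |inner ℝ (T x) x| ≤ c * ‖x‖ ^ 2 := by
    intro x
    by_cases hx : x = 0
    · simp [hx]
    have hxp : 0 < ‖x‖ := norm_pos_iff.2 hx
    have := h (‖x‖⁻¹ • x) (by rw [norm_smul, norm_inv, norm_norm, inv_mul_cancel₀ hxp.ne'])
    rw [map_smul, real_inner_smul_left, real_inner_smul_right, ← mul_assoc, abs_mul,
      abs_of_nonneg (by positivity)] at this
    calc |inner ℝ (T x) x| = ‖x‖ ^ 2 * (‖x‖⁻¹ * ‖x‖⁻¹ * |inner ℝ (T x) x|) := by field_simp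
      _ ≤ ‖x‖ ^ 2 * c := by gcongr
      _ = _ := mul_comm _ _
  refine T.opNorm_le_bound hc fun x => ?_
  by_cases hT : T x = 0
  · rw [hT, norm_zero]; positivity
  have hTp : 0 < ‖T x‖ := norm_pos_iff.2 hT
  by_cases hx : x = 0
  · simp [hx] at hT
  have hxp : 0 < ‖x‖ := norm_pos_iff.2 hx
  set y := (‖x‖ / ‖T x‖) • T x with hy
  have hny : ‖y‖ = ‖x‖ := by
    rw [hy, norm_smul, Real.norm_of_nonneg (by positivity), div_mul_cancel₀ _ hTp.ne']
  have hin : inner ℝ (T x) y = ‖x‖ * ‖T x‖ := by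
    rw [hy, real_inner_smul_right, real_inner_self_eq_norm_sq]; field_simp
  have h1 := (abs_le.1 (hq (x + y))).2
  have h2 := (abs_le.1 (hq (x - y))).1
  have h3 := parallelogram_law_with_norm ℝ x y
  have h4 := hsymm x y
  simp only [map_add, map_sub, inner_add_left, inner_add_right, inner_sub_left,
    inner_sub_right] at h1 h2
  rw [hny] at h3
  have h5 : ‖x‖ * ‖T x‖ ≤ ‖x‖ * (c * ‖x‖) := by
    have : c * (‖x + y‖ ^ 2 + ‖x - y‖ ^ 2) = c * (4 * (‖x‖ * ‖x‖)) := by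
      rw [h3]; ring
    nlinarith
  exact le_of_mul_le_mul_left h5 hxp

/-- The gradient of `u ↦ ⅓ ‖u‖³`. -/
noncomputable def cubicGrad (u : Vec n) : Vec n := ‖u‖ • u

/-- The Hessian of `u ↦ ⅓ ‖u‖³`. -/
noncomputable def cubicHess (u : Vec n) : Vec n →L[ℝ] Vec n :=
  ‖u‖ • ContinuousLinearMap.id ℝ (Vec n) + ‖u‖⁻¹ • (innerSL ℝ u).smulRight u

theorem cubicHess_apply (u s : Vec n) :
    cubicHess u s = ‖u‖ • s + (‖u‖⁻¹ * inner ℝ u s) • u := by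
  simp [cubicHess, smul_smul]

theorem inner_cubicHess (u s t : Vec n) :
    inner ℝ (cubicHess u s) t = ‖u‖ * inner ℝ s t + ‖u‖⁻¹ * inner ℝ u s * inner ℝ u t := by
  rw [cubicHess_apply, inner_add_left, real_inner_smul_left, real_inner_smul_left]

theorem hasFDerivAt_cubicGrad (u : Vec n) : HasFDerivAt cubicGrad (cubicHess u) u := by
  by_cases hu : u = 0
  -- Here `‖u‖⁻¹` is 0, so `cubicHess 0` vanishes, and the remainder has norm $\|v\|^2$.
  · subst hu
    rw [hasFDerivAt_iff_isLittleO_nhds_zero, Asymptotics.isLittleO_iff]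
    intro c hc
    filter_upwards [Metric.ball_mem_nhds (0 : Vec n) hc] with v hv
    rw [cubicHess_apply]
    simp only [cubicGrad, zero_add, norm_zero, zero_smul, smul_zero, sub_zero, norm_smul, norm_norm]
    gcongr
    simpa using (mem_ball_zero_iff.1 hv).le
  have hup : 0 < ‖u‖ := norm_pos_iff.2 hu
  have hn : HasFDerivAt (fun v : Vec n => ‖v‖) (‖u‖⁻¹ • innerSL ℝ u) u := by
    have h1 := (hasStrictFDerivAt_norm_sq u).hasFDerivAt.sqrt (by positivity)
    simp only [Real.sqrt_sq (norm_nonneg _)] at h1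
    refine h1.congr_fderiv ?_
    ext s
    simp
    field_simp
  refine (hn.smul (hasFDerivAt_id u)).congr_fderiv ?_
  ext1 s
  rw [cubicHess_apply]
  simp

theorem hasGradientAt_cubic (u : Vec n) :
    HasGradientAt (fun u : Vec n => (1 / 3) * ‖u‖ ^ 3) (cubicGrad u) u := by
  have h1 := (hasFDerivAt_norm_rpow u (p := 3) (by norm_num)).const_mul (1 / 3)
  rw [hasGradientAt_iff_hasFDerivAt]
  have e : (fun u : Vec n => (1 / 3) * ‖u‖ ^ 3) = fun u => (1 / 3) * ‖u‖ ^ (3 : ℝ) := by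
    funext u; norm_cast
  rw [e]
  refine h1.congr_fderiv ?_
  ext s
  simp [cubicGrad]
  norm_num
  ring

/-- Scalar core of the Lipschitz constant 2 of `cubicHess`. For $u=ae$, $v=bg$ and a unit vector
$s$: $\alpha,\beta$ are the components of $e,g$ along $s$, $X,Y$ the lengths of the orthogonal
parts, and $\gamma=\langle e,g\rangle$. As $4-(1+\alpha^2)^2=(1-\alpha^2)(3+\alpha^2)=(Xp)^2$, the
difference of the sides is at least $(aXp-bYq)^2$ once `h2` is known. -/
theorem quadratic_form_gap {a b α β γ X Y : ℝ} (ha : 0 ≤ a) (hb : 0 ≤ b) (hX : 0 ≤ X)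
    (hY : 0 ≤ Y) (hXα : X ^ 2 = 1 - α ^ 2) (hYβ : Y ^ 2 = 1 - β ^ 2) (hγ : γ ≤ α * β + X * Y) :
    (a * (1 + α ^ 2) - b * (1 + β ^ 2)) ^ 2 ≤ 4 * (a ^ 2 + b ^ 2 - 2 * a * b * γ) := by
  set p := √(3 + α ^ 2)
  set q := √(3 + β ^ 2)
  have hp0 : 0 ≤ p := Real.sqrt_nonneg _
  have hq0 : 0 ≤ q := Real.sqrt_nonneg _
  have hp : p ^ 2 = 3 + α ^ 2 := Real.sq_sqrt (by positivity)
  have hq : q ^ 2 = 3 + β ^ 2 := Real.sq_sqrt (by positivity)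
  have hpq : 3 + α * β ≤ p * q := by
    refine le_of_sq_le_sq ?_ (by positivity)
    rw [mul_pow, hp, hq]
    nlinarith [sq_nonneg (α - β)]
  have hXY : X * Y ≤ 1 - α * β := by nlinarith [sq_nonneg (X - Y), sq_nonneg (α - β)]
  have hXY0 : 0 ≤ X * Y := by positivity
  have h1 : 0 ≤ 1 - α * β := hXY0.trans hXY
  -- Split $4XY=XY(3+\alpha\beta)+XY(1-\alpha\beta)$; what remains is $-(\alpha-\beta)^2\le0$.
  have h2 : 4 * γ - (1 + α ^ 2) * (1 + β ^ 2) ≤ X * p * (Y * q) := by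
    have h3 : X * Y * (3 + α * β) ≤ X * Y * (p * q) := by gcongr
    have h4 : X * Y * (1 - α * β) ≤ (1 - α * β) * (1 - α * β) := by gcongr
    nlinarith [sq_nonneg (α - β)]
  have h5 : 0 ≤ a * b := by positivity
  have h6 := mul_le_mul_of_nonneg_left h2 h5
  have h7 : (X * p) ^ 2 = (1 - α ^ 2) * (3 + α ^ 2) := by rw [mul_pow, hXα, hp]
  have h8 : (Y * q) ^ 2 = (1 - β ^ 2) * (3 + β ^ 2) := by rw [mul_pow, hYβ, hq]
  have h9 := sq_nonneg (a * (X * p) - b * (Y * q))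
  have h10 : a ^ 2 * (X * p) ^ 2 = a ^ 2 * ((1 - α ^ 2) * (3 + α ^ 2)) := by rw [h7]
  have h11 : b ^ 2 * (Y * q) ^ 2 = b ^ 2 * ((1 - β ^ 2) * (3 + β ^ 2)) := by rw [h8]
  nlinarith

theorem exists_unit_smul (u : Vec n) (hu : u ≠ 0) : ∃ e : Vec n, ‖e‖ = 1 ∧ u = ‖u‖ • e :=
  ⟨‖u‖⁻¹ • u, by rw [norm_smul, norm_inv, norm_norm, inv_mul_cancel₀ (norm_ne_zero_iff.2 hu)],
    by rw [smul_smul, mul_inv_cancel₀ (norm_ne_zero_iff.2 hu), one_smul]⟩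

theorem inner_cubicHess_sub_le (u v s : Vec n) (hs : ‖s‖ = 1) :
    inner ℝ (cubicHess u s) s - inner ℝ (cubicHess v s) s ≤ 2 * ‖u - v‖ := by
  have hpos : ∀ w : Vec n, 0 ≤ inner ℝ (cubicHess w s) s := by
    intro w
    rw [inner_cubicHess, mul_assoc, real_inner_self_eq_norm_sq]
    have := mul_self_nonneg (inner ℝ w s)
    positivity
  by_cases hu : u = 0
  · have := hpos v
    subst hu
    rw [inner_cubicHess]
    simp only [norm_zero, zero_mul, inv_zero, zero_add]
    have := norm_nonneg (0 - v)
    linarith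
  obtain ⟨e, he, hue⟩ := exists_unit_smul u hu
  have hform : ∀ (a : ℝ) (e : Vec n), ‖e‖ = 1 → 0 < a →
      inner ℝ (cubicHess (a • e) s) s = a * (1 + inner ℝ e s ^ 2) := by
    intro a e he ha
    rw [inner_cubicHess, real_inner_smul_left, norm_smul, he, Real.norm_of_nonneg ha.le,
      real_inner_self_eq_norm_sq, hs]
    field_simp
  have hup : 0 < ‖u‖ := norm_pos_iff.2 hu
  have hle1 : ∀ e : Vec n, ‖e‖ = 1 → inner ℝ e s ^ 2 ≤ 1 := by
    intro e he
    have := abs_real_inner_le_norm e s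
    rw [he, hs, one_mul] at this
    rw [← sq_abs]
    exact pow_le_one₀ (abs_nonneg _) this
  by_cases hv : v = 0
  · subst hv
    have h0 : inner ℝ (cubicHess (0 : Vec n) s) s = 0 := by rw [inner_cubicHess]; simp
    rw [h0, sub_zero, sub_zero, hue, hform _ e he hup, norm_smul, he, norm_norm]
    nlinarith [hle1 e he]
  obtain ⟨g, hg, hvg⟩ := exists_unit_smul v hv
  have hvp : 0 < ‖v‖ := norm_pos_iff.2 hv
  set a := ‖u‖
  set b := ‖v‖
  rw [hue, hvg, hform a e he hup, hform b g hg hvp]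
  refine le_of_sq_le_sq ?_ (by positivity)
  have hnorm : (2 * ‖a • e - b • g‖) ^ 2 = 4 * (a ^ 2 + b ^ 2 - 2 * a * b * inner ℝ e g) := by
    rw [mul_pow, norm_sub_sq_real, norm_smul, norm_smul, he, hg, real_inner_smul_left,
      real_inner_smul_right, Real.norm_of_nonneg hup.le, Real.norm_of_nonneg hvp.le]
    ring
  rw [hnorm]
  have hres : ∀ e : Vec n, ‖e‖ = 1 → ‖e - inner ℝ e s • s‖ ^ 2 = 1 - inner ℝ e s ^ 2 := by
    intro e he
    rw [norm_sub_sq_real, norm_smul, he, hs, real_inner_smul_right, Real.norm_eq_abs, mul_one,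
      sq_abs]
    ring
  refine quadratic_form_gap hup.le hvp.le (norm_nonneg _) (norm_nonneg _) (hres e he) (hres g hg) ?_
  have h1 := real_inner_le_norm (e - inner ℝ e s • s) (g - inner ℝ g s • s)
  rw [inner_sub_left, inner_sub_right, inner_sub_right, real_inner_smul_left, real_inner_smul_right,
    real_inner_smul_right, real_inner_smul_left, real_inner_self_eq_norm_sq, hs,
    real_inner_comm g s] at h1
  linarith

theorem norm_cubicHess_sub_le (u v : Vec n) : ‖cubicHess u - cubicHess v‖ ≤ 2 * ‖u - v‖ := by
  refine norm_le_of_forall_abs_inner_le (by positivity) (fun x y => ?_) fun s hs => ?_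
  · rw [sub_apply, sub_apply, inner_sub_left, inner_sub_left]
    simp only [inner_cubicHess]
    rw [real_inner_comm x y]
    ring
  · rw [sub_apply, inner_sub_left, abs_le]
    have h1 := inner_cubicHess_sub_le u v s hs
    have h2 := inner_cubicHess_sub_le v u s hs
    rw [norm_sub_rev] at h2
    constructor <;> linarith

theorem continuous_cubicHess : Continuous (cubicHess : Vec n → Vec n →L[ℝ] Vec n) := by
  have : LipschitzWith 2 (cubicHess : Vec n → Vec n →L[ℝ] Vec n) :=
    LipschitzWith.of_dist_le_mul fun u v => by
      rw [dist_eq_norm, dist_eq_norm]; exact norm_cubicHess_sub_le u v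
  exact this.continuous

theorem contDiff_cubicGrad : ContDiff ℝ 1 (cubicGrad : Vec n → Vec n) :=
  contDiff_one_iff_hasFDerivAt.2 ⟨cubicHess, continuous_cubicHess, hasFDerivAt_cubicGrad⟩

theorem hasGradientAt_prox (x₀ x : Vec n) : HasGradientAt (prox x₀) (cubicGrad (x - x₀)) x := by
  rw [hasGradientAt_iff_hasFDerivAt]
  have := (hasGradientAt_cubic (x - x₀)).hasFDerivAt.comp x ((hasFDerivAt_id x).sub_const x₀)
  exact this

theorem gradient_prox (x₀ x : Vec n) : gradient (prox x₀) x = cubicGrad (x - x₀) :=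
  (hasGradientAt_prox x₀ x).gradient

theorem bregman_eq (x₀ x y : Vec n) : bregman x₀ x y =
    1 / 3 * ‖y - x₀‖ ^ 3 - 1 / 3 * ‖x - x₀‖ ^ 3
      - inner ℝ (cubicGrad (x - x₀)) (y - x) := by
  rw [bregman, gradient_prox, prox, prox]

theorem bregman_self_left (x₀ y : Vec n) : bregman x₀ x₀ y = 1 / 3 * ‖y - x₀‖ ^ 3 := by
  simp [bregman_eq, cubicGrad]

/-- With $a=\|u\|$, $b=\|v\|$, $w=\|v-u\|$ the right side is six times the divergence minus $w^3$.
If $w>3a$, then $b\ge w-a$ reduces it to $(w-2a)^3+4a^3\ge0$. -/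
theorem cubic_scalar_inequality {a b w : ℝ} (ha : 0 ≤ a) (hb : 0 ≤ b)
    (hwab : w ≤ a + b) : 0 ≤ (b - a) ^ 2 * (2 * b + a) + w ^ 2 * (3 * a - w) := by
  by_cases h : w ≤ 3 * a
  · have : 0 ≤ 3 * a - w := by linarith
    positivity
  push Not at h
  have h1 : (w - 2 * a) ^ 2 * (2 * w - a) ≤ (b - a) ^ 2 * (2 * b + a) := by
    refine mul_le_mul (pow_le_pow_left₀ ?_ ?_ 2) ?_ ?_ (by positivity) <;> linarith
  have h2 : 0 ≤ (w - 2 * a) ^ 3 := pow_nonneg (by linarith) 3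
  have h3 : 0 ≤ a ^ 3 := by positivity
  nlinarith

/-- Uniform convexity of the cubic prox function. -/
theorem le_bregman (x₀ x y : Vec n) : 1 / 6 * ‖y - x‖ ^ 3 ≤ bregman x₀ x y := by
  rw [bregman_eq, cubicGrad, real_inner_smul_left]
  have hyx : y - x = (y - x₀) - (x - x₀) := by abel
  rw [hyx]
  set u := x - x₀
  set v := y - x₀
  have h1 := cubic_scalar_inequality (w := ‖v - u‖) (norm_nonneg u) (norm_nonneg v)
    (by rw [add_comm]; exact norm_sub_le v u)
  have h2 := norm_sub_sq_real v u
  rw [inner_sub_right, real_inner_self_eq_norm_sq]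
  rw [real_inner_comm] at h2
  have h3 : inner ℝ u v = (‖v‖ ^ 2 + ‖u‖ ^ 2 - ‖v - u‖ ^ 2) / 2 := by linarith
  rw [h3]
  nlinarith

theorem bregman_three_point (x₀ u v x : Vec n) :
    bregman x₀ u x = bregman x₀ v x + bregman x₀ u v +
      inner ℝ (cubicGrad (v - x₀) - cubicGrad (u - x₀)) (x - v) := by
  simp only [bregman_eq]
  have : x - u = (x - v) + (v - u) := by abel
  rw [this, inner_add_right, inner_sub_left]
  ring

/-! ### The auxiliary functions of the accelerated method -/

theorem aCoef_nonneg {M : ℝ} (hM : 0 < M) (k : ℕ) : 0 ≤ aCoef M k := by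
  unfold aCoef; positivity

theorem le_ACoef {M : ℝ} (hM : 0 < M) (k : ℕ) : (k : ℝ) ^ 3 / (27 * M) ≤ ACoef M k := by
  induction k with
  | zero => simp [ACoef]
  | succ k ih =>
    have h1 : ((k + 1 : ℕ) : ℝ) ^ 3 / (27 * M) ≤ (k : ℝ) ^ 3 / (27 * M) + aCoef M (k + 1) := by
      unfold aCoef
      have hk : (0 : ℝ) ≤ k := k.cast_nonneg
      rw [div_add_div _ _ (by positivity) (by positivity), div_le_div_iff₀ (by positivity)
        (by positivity)]
      push_cast
      have : 0 ≤ M ^ 2 * (3 * (k : ℝ) + 2) := by positivity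
      nlinarith
    simp only [ACoef]
    linarith

theorem ACoef_nonneg {M : ℝ} (hM : 0 < M) (k : ℕ) : 0 ≤ ACoef M k :=
  le_trans (by positivity) (le_ACoef hM k)

theorem ACoef_succ_pos {M : ℝ} (hM : 0 < M) (k : ℕ) : 0 < ACoef M (k + 1) :=
  lt_of_lt_of_le (by positivity) (le_ACoef hM (k + 1))

theorem contract_sub {M : ℝ} (k : ℕ) (p y y' : Vec n) :
    contract M k p y - contract M k p y' = ((ACoef M (k + 1))⁻¹ * aCoef M (k + 1)) • (y - y') := by
  simp only [contract]
  module

theorem ACoef_smul_contract {M : ℝ} (hM : 0 < M) (k : ℕ) (p y : Vec n) :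
    ACoef M (k + 1) • contract M k p y = aCoef M (k + 1) • y + ACoef M k • p := by
  rw [contract, smul_smul, mul_inv_cancel₀ (ACoef_succ_pos hM k).ne', one_smul]

theorem norm_contract_sub_le {M : ℝ} (hM : 0 < M) (k : ℕ) {p y w : Vec n} {P : ℝ}
    (hp : ‖p - w‖ ≤ P) (hy : ‖y - w‖ ≤ P) : ‖contract M k p y - w‖ ≤ P := by
  have hA := ACoef_succ_pos hM k
  have ha := aCoef_nonneg hM (k + 1)
  have hA' := ACoef_nonneg hM k
  have e : ACoef M (k + 1) • (contract M k p y - w)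
      = aCoef M (k + 1) • (y - w) + ACoef M k • (p - w) := by
    rw [smul_sub, ACoef_smul_contract hM]
    simp only [ACoef]
    module
  have h1 : ACoef M (k + 1) * ‖contract M k p y - w‖ ≤ ACoef M (k + 1) * P := by
    calc _ = ‖ACoef M (k + 1) • (contract M k p y - w)‖ := by
          rw [norm_smul, Real.norm_of_nonneg hA.le]
      _ ≤ aCoef M (k + 1) * ‖y - w‖ + ACoef M k * ‖p - w‖ := by
          rw [e]
          refine (norm_add_le _ _).trans_eq ?_
          rw [norm_smul, norm_smul, Real.norm_of_nonneg ha, Real.norm_of_nonneg hA']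
      _ ≤ aCoef M (k + 1) * P + ACoef M k * P := by gcongr
      _ = _ := by simp only [ACoef]; ring
  exact le_of_mul_le_mul_left h1 hA

theorem hasFDerivAt_contract (M : ℝ) (k : ℕ) (p y : Vec n) :
    HasFDerivAt (contract M k p)
      (((ACoef M (k + 1))⁻¹ * aCoef M (k + 1)) • ContinuousLinearMap.id ℝ (Vec n)) y := by
  have h1 : HasFDerivAt (fun y => aCoef M (k + 1) • y + ACoef M k • p)
      (aCoef M (k + 1) • ContinuousLinearMap.id ℝ (Vec n)) y :=
    ((hasFDerivAt_id (𝕜 := ℝ) y).const_smul (aCoef M (k + 1))).add_const (ACoef M k • p)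
  have h2 := h1.const_smul (ACoef M (k + 1))⁻¹
  rw [smul_smul] at h2
  exact h2

theorem hasGradientAt_aux {f : Vec n → ℝ} (hf : ContDiff ℝ 2 f) {M : ℝ} (hM : 0 < M) (x₀ : Vec n)
    (k : ℕ) (p v y : Vec n) :
    HasGradientAt (aux f M x₀ k p v) (aCoef M (k + 1) • gradient f (contract M k p y) +
      (cubicGrad (y - x₀) - cubicGrad (v - x₀))) y := by
  have hA := (ACoef_succ_pos hM k).ne'
  rw [hasGradientAt_iff_hasFDerivAt]
  have h1 := ((hasGradientAt_of_contDiff hf (contract M k p y)).hasFDerivAt.comp y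
    (hasFDerivAt_contract M k p y)).const_mul (ACoef M (k + 1))
  have h2 := (((hasGradientAt_prox x₀ y).hasFDerivAt).sub_const (prox x₀ v)).sub
    ((hasFDerivAt_const (gradient (prox x₀) v) y).inner ℝ ((hasFDerivAt_id y).sub_const v))
  refine (h1.add h2).congr_fderiv ?_
  rw [gradient_prox]
  ext s
  simp
  field_simp

theorem gradient_aux {f : Vec n → ℝ} (hf : ContDiff ℝ 2 f) {M : ℝ} (hM : 0 < M) (x₀ : Vec n)
    (k : ℕ) (p v y : Vec n) :
    gradient (aux f M x₀ k p v) y = aCoef M (k + 1) • gradient f (contract M k p y) +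
      (cubicGrad (y - x₀) - cubicGrad (v - x₀)) :=
  (hasGradientAt_aux hf hM x₀ k p v y).gradient

theorem contDiff_aux {f : Vec n → ℝ} (hf : ContDiff ℝ 2 f) {M : ℝ} (hM : 0 < M) (x₀ : Vec n)
    (k : ℕ) (p v : Vec n) : ContDiff ℝ 2 (aux f M x₀ k p v) := by
  refine contDiff_two_of_hasGradientAt (hasGradientAt_aux hf hM x₀ k p v) ?_
  have hc : ContDiff ℝ 1 (contract M k p) := by unfold contract; fun_prop
  have h1 := (contDiff_gradient hf).comp hc
  have h2 : ContDiff ℝ 1 (fun y : Vec n => cubicGrad (y - x₀)) :=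
    contDiff_cubicGrad.comp (contDiff_id.sub contDiff_const)
  exact (h1.const_smul (aCoef M (k + 1))).add (h2.sub contDiff_const)

theorem hess_aux {f : Vec n → ℝ} (hf : ContDiff ℝ 2 f) {M : ℝ} (hM : 0 < M) (x₀ : Vec n)
    (k : ℕ) (p v y : Vec n) :
    hess (aux f M x₀ k p v) y =
      (aCoef M (k + 1) * ((ACoef M (k + 1))⁻¹ * aCoef M (k + 1))) • hess f (contract M k p y)
        + cubicHess (y - x₀) := by
  have e : gradient (aux f M x₀ k p v) = fun y => aCoef M (k + 1) • gradient f (contract M k p y) +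
      (cubicGrad (y - x₀) - cubicGrad (v - x₀)) := funext (gradient_aux hf hM x₀ k p v)
  have h1 := ((hasFDerivAt_gradient hf (contract M k p y)).comp y
    (hasFDerivAt_contract M k p y)).const_smul (aCoef M (k + 1))
  have h2 := ((hasFDerivAt_cubicGrad (y - x₀)).comp y ((hasFDerivAt_id y).sub_const x₀)).sub_const
    (cubicGrad (v - x₀))
  unfold hess
  rw [e]
  refine ((h1.add h2).congr_fderiv ?_).fderiv
  ext1 s
  simp [hess, smul_smul]

/-- The normalization $9M$ makes $Ma_k^3$ exactly the square of the lower bound $k^3/(27M)$ for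
$A_k$. -/
theorem aCoef_cube_le {M : ℝ} (hM : 0 < M) (k : ℕ) :
    M * aCoef M (k + 1) ^ 3 ≤ ACoef M (k + 1) ^ 2 := by
  have h := le_ACoef hM (k + 1)
  calc M * aCoef M (k + 1) ^ 3 = (((k + 1 : ℕ) : ℝ) ^ 3 / (27 * M)) ^ 2 := by
        unfold aCoef; field_simp; norm_num
    _ ≤ _ := by gcongr

theorem hasLipschitzHessian_aux {f : Vec n → ℝ} {M : ℝ} (hM : 0 < M)
    (hf : HasLipschitzHessian f M) (x₀ : Vec n) (k : ℕ) (p v : Vec n) :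
    HasLipschitzHessian (aux f M x₀ k p v) auxLip := by
  refine ⟨contDiff_aux hf.1 hM x₀ k p v, fun x y => ?_⟩
  rw [hess_aux hf.1 hM, hess_aux hf.1 hM]
  have hA := ACoef_succ_pos hM k
  have ha := aCoef_nonneg hM (k + 1)
  set θ := aCoef M (k + 1) * ((ACoef M (k + 1))⁻¹ * aCoef M (k + 1)) with hθ
  have hθ0 : 0 ≤ θ := by positivity
  have e : θ • hess f (contract M k p x) + cubicHess (x - x₀)
      - (θ • hess f (contract M k p y) + cubicHess (y - x₀))
      = θ • (hess f (contract M k p x) - hess f (contract M k p y))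
        + (cubicHess (x - x₀) - cubicHess (y - x₀)) := by
    rw [smul_sub]; abel
  rw [e]
  have h1 := hf.2 (contract M k p x) (contract M k p y)
  rw [contract_sub, norm_smul, Real.norm_of_nonneg (by positivity)] at h1
  have h2 := norm_cubicHess_sub_le (x - x₀) (y - x₀)
  rw [sub_sub_sub_cancel_right] at h2
  have h3 : θ * (M * ((ACoef M (k + 1))⁻¹ * aCoef M (k + 1))) ≤ 1 := by
    calc _ = M * aCoef M (k + 1) ^ 3 / ACoef M (k + 1) ^ 2 := by rw [hθ]; field_simp
      _ ≤ 1 := (div_le_one (by positivity)).2 (aCoef_cube_le hM k)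
  refine (norm_add_le _ _).trans ?_
  rw [norm_smul, Real.norm_of_nonneg hθ0]
  have h4 : θ * ‖hess f (contract M k p x) - hess f (contract M k p y)‖ ≤ 1 * ‖x - y‖ := by
    calc _ ≤ θ * (M * ((ACoef M (k + 1))⁻¹ * aCoef M (k + 1) * ‖x - y‖)) := by gcongr
      _ = θ * (M * ((ACoef M (k + 1))⁻¹ * aCoef M (k + 1))) * ‖x - y‖ := by ring
      _ ≤ _ := by gcongr
  unfold auxLip
  linarith

/-- By the three-point identity, $\beta_d(v;\cdot)$ differs from $\beta_d(x;\cdot)$ by an affine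
function, so it inherits the modulus of `le_bregman`; the contracted part is convex. -/
theorem isCubicallyConvex_aux {f : Vec n → ℝ} {M : ℝ} (hM : 0 < M)
    (hf : ContDiff ℝ 2 f) (hc : ConvexOn ℝ univ f) (x₀ : Vec n) (k : ℕ) (p v : Vec n) :
    IsCubicallyConvex (aux f M x₀ k p v) := by
  intro x y
  have hA := ACoef_succ_pos hM k
  rw [gradient_aux hf hM, aux, aux, inner_add_left, real_inner_smul_left,
    bregman_three_point x₀ v x y]
  have h1 := mul_le_mul_of_nonneg_left
    (gradient_inequality hf hc (contract M k p x) (contract M k p y)) hA.le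
  rw [contract_sub, real_inner_smul_right, mul_add, ← mul_assoc, ← mul_assoc,
    mul_inv_cancel₀ hA.ne', one_mul] at h1
  have h2 := le_bregman x₀ x y
  linarith

/-! ### Runs of the accelerated method -/

theorem exists_isAcceleratedRun {f : Vec n → ℝ} {M : ℝ} (hM : 0 < M)
    (hf : HasLipschitzHessian f M) (hc : ConvexOn ℝ univ f) (x₀ : Vec n) {δ : ℝ} (hδ : 0 < δ) :
    ∃ (x v : ℕ → Vec n) (z : ℕ → ℕ → Vec n) (T : ℕ → ℕ), IsAcceleratedRun f M x₀ δ x v z T := by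
  classical
  have step : ∀ (k : ℕ) (p v : Vec n), ∃ zT : (ℕ → Vec n) × ℕ,
      IsUTRSequence (aux f M x₀ k p v) auxLip v zT.1 ∧
      ‖gradient (aux f M x₀ k p v) (zT.1 zT.2)‖ ≤ δ ∧
      ∀ i < zT.2, δ < ‖gradient (aux f M x₀ k p v) (zT.1 i)‖ := by
    intro k p v
    obtain ⟨z, hz⟩ := exists_isUTRSequence (aux f M x₀ k p v) auxLip v
    obtain ⟨C, -, hC⟩ := exists_inner_iteration_bound
    have hex : ∃ i, ‖gradient (aux f M x₀ k p v) (z i)‖ ≤ δ := by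
      by_contra! hcon
      obtain ⟨N, hN⟩ := exists_nat_gt
        (C * (1 + Real.log (‖gradient (aux f M x₀ k p v) v‖ / δ)))
      exact (hC n _ v z δ hδ (hasLipschitzHessian_aux hM hf x₀ k p v)
        (isCubicallyConvex_aux hM hf.1 hc x₀ k p v) hz N fun i _ => hcon i).not_gt hN
    exact ⟨(z, Nat.find hex), hz, Nat.find_spec hex, fun i hi => not_le.1 (Nat.find_min hex hi)⟩
  choose F hF using step
  let S : ℕ → Vec n × Vec n := fun k => Nat.rec (x₀, x₀) (fun k p =>
    (contract M k p.1 ((F k p.1 p.2).1 (F k p.1 p.2).2), (F k p.1 p.2).1 (F k p.1 p.2).2)) k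
  exact ⟨fun k => (S k).1, fun k => (S k).2, fun k => (F k (S k).1 (S k).2).1,
    fun k => (F k (S k).1 (S k).2).2,
    { x_zero := rfl
      v_zero := rfl
      inner_run := fun k => (hF k _ _).1
      inner_stop := fun k => (hF k _ _).2.1
      inner_first := fun k => (hF k _ _).2.2
      v_succ := fun k => rfl
      x_succ := fun k => rfl }⟩

namespace IsAcceleratedRun

variable {f : Vec n → ℝ} {M : ℝ} {x₀ : Vec n} {δ : ℝ} {x v : ℕ → Vec n} {z : ℕ → ℕ → Vec n}
  {T : ℕ → ℕ}

theorem energy_le (hr : IsAcceleratedRun f M x₀ δ x v z T) (hM : 0 < M) (hf : ContDiff ℝ 2 f)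
    (hc : ConvexOn ℝ univ f) (w : Vec n) (k : ℕ) :
    ACoef M k * (f (x k) - f w) + bregman x₀ (v k) w
      ≤ bregman x₀ x₀ w + δ * ∑ j ∈ Finset.range k, ‖v (j + 1) - w‖ := by
  induction k with
  | zero => simp [ACoef, hr.v_zero]
  | succ k ih =>
    rw [Finset.sum_range_succ]
    have hdelta := hr.inner_stop k
    rw [← hr.v_succ, gradient_aux hf hM, ← hr.x_succ] at hdelta
    set g := gradient f (x (k + 1))
    set r := cubicGrad (v (k + 1) - x₀) - cubicGrad (v k - x₀)
    have h3 := bregman_three_point x₀ (v k) (v (k + 1)) w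
    have hpos : 0 ≤ bregman x₀ (v k) (v (k + 1)) :=
      le_trans (by positivity) (le_bregman x₀ (v k) (v (k + 1)))
    have herr := (abs_le.1 (abs_real_inner_le_norm (aCoef M (k + 1) • g + r) (w - v (k + 1)))).1
    have herr' : ‖aCoef M (k + 1) • g + r‖ * ‖w - v (k + 1)‖ ≤ δ * ‖v (k + 1) - w‖ := by
      rw [norm_sub_rev w]; gcongr
    rw [inner_add_left, real_inner_smul_left] at herr
    have hg1 := mul_le_mul_of_nonneg_left (gradient_inequality hf hc (x (k + 1)) w)
      (aCoef_nonneg hM (k + 1))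
    have hg2 := mul_le_mul_of_nonneg_left (gradient_inequality hf hc (x (k + 1)) (x k))
      (ACoef_nonneg hM k)
    -- The gradient inequalities at $x_{k+1}$ towards $w$ and $x_k$, weighted by $a_{k+1}$ and
    -- $A_k$, combine to a term at $v_{k+1}$, where the inner residual is controlled.
    have hcomb : aCoef M (k + 1) * inner ℝ g (w - x (k + 1))
        + ACoef M k * inner ℝ g (x k - x (k + 1))
        = aCoef M (k + 1) * inner ℝ g (w - v (k + 1)) := by
      have e : aCoef M (k + 1) • (w - x (k + 1)) + ACoef M k • (x k - x (k + 1))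
          = aCoef M (k + 1) • (w - v (k + 1)) := by
        have := ACoef_smul_contract hM k (x k) (v (k + 1))
        rw [← hr.x_succ] at this
        simp only [ACoef] at this
        rw [add_smul] at this
        calc _ = aCoef M (k + 1) • w + ACoef M k • x k
              - (ACoef M k • x (k + 1) + aCoef M (k + 1) • x (k + 1)) := by module
          _ = _ := by rw [this]; module
      rw [← real_inner_smul_right, ← real_inner_smul_right, ← inner_add_right, e,
        real_inner_smul_right]
    simp only [ACoef]
    linarith

/-- Apply the energy bound at the index where $\|v_j-w\|$ is largest: the error is at most $d^2P$,
linear in $P$, while the divergence supplies $\frac16P^3$, so $P$ is bounded. The energy bound at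
$K$ then gives the gap. -/
theorem exists_radius (hr : IsAcceleratedRun f M x₀ δ x v z T) (hM : 0 < M) (hδ : 0 ≤ δ)
    (hf : ContDiff ℝ 2 f) (hc : ConvexOn ℝ univ f) {w : Vec n} (hw : ∀ y, f w ≤ f y) (K : ℕ)
    {d : ℝ} (hd : 0 ≤ d) (hδd : δ * K ≤ d ^ 2) :
    ∃ P : ℝ, (∀ j ≤ K, ‖v j - w‖ ≤ P) ∧ P ≤ 2 * ‖x₀ - w‖ + 3 * d ∧
      ACoef M K * (f (x K) - f w) ≤ ‖x₀ - w‖ ^ 3 + 5 * d ^ 3 := by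
  obtain ⟨j₀, hj₀, hmax⟩ := Finset.exists_max_image (Finset.range (K + 1)) (fun j => ‖v j - w‖)
    ⟨0, by simp⟩
  have hmax' : ∀ j ≤ K, ‖v j - w‖ ≤ ‖v j₀ - w‖ := fun j hj => hmax j (by simp; omega)
  have hj₀K : j₀ ≤ K := by simpa [Nat.lt_succ_iff] using hj₀
  have hP0 := norm_nonneg (v j₀ - w)
  have hR0 := norm_nonneg (x₀ - w)
  have hb0 := bregman_self_left x₀ w
  rw [norm_sub_rev] at hb0
  have hsum : ∀ k ≤ K, δ * ∑ j ∈ Finset.range k, ‖v (j + 1) - w‖ ≤ d ^ 2 * ‖v j₀ - w‖ := by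
    intro k hk
    calc δ * ∑ j ∈ Finset.range k, ‖v (j + 1) - w‖
        ≤ δ * ∑ j ∈ Finset.range k, ‖v j₀ - w‖ := by
          gcongr with j hj
          exact hmax' _ (by have := Finset.mem_range.1 hj; omega)
      _ = δ * k * ‖v j₀ - w‖ := by simp [mul_assoc]
      _ ≤ δ * K * ‖v j₀ - w‖ := by gcongr
      _ ≤ _ := by gcongr
  set P := ‖v j₀ - w‖
  set R := ‖x₀ - w‖
  have hcube : 1 / 6 * P ^ 3 ≤ 1 / 3 * R ^ 3 + d ^ 2 * P := by
    have h1 := hr.energy_le hM hf hc w j₀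
    have h2 := hsum j₀ hj₀K
    have h3 := le_bregman x₀ (v j₀) w
    rw [norm_sub_rev] at h3
    have h4 : 0 ≤ ACoef M j₀ * (f (x j₀) - f w) :=
      mul_nonneg (ACoef_nonneg hM j₀) (sub_nonneg.2 (hw _))
    linarith
  have hPle : P ≤ 2 * R + 3 * d := by
    refine le_of_pow_le_pow_left₀ (n := 3) (by norm_num) (by positivity) ?_
    -- Young's inequality in the form $6d^2P\le\frac12P^3+8d^3$.
    have hyoung : 0 ≤ (P - 2 * d) ^ 2 * (P + 4 * d) := by positivity
    have h1 : 0 ≤ R ^ 2 * d := by positivity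
    have h2 : 0 ≤ R * d ^ 2 := by positivity
    have h3 : 0 ≤ R ^ 3 := by positivity
    have h4 : 0 ≤ d ^ 3 := by positivity
    nlinarith
  refine ⟨P, hmax', hPle, ?_⟩
  have h1 := hr.energy_le hM hf hc w K
  have h2 := hsum K le_rfl
  have h3 : 0 ≤ bregman x₀ (v K) w := le_trans (by positivity) (le_bregman x₀ (v K) w)
  have h4 : d ^ 2 * P ≤ d ^ 2 * (2 * R + 3 * d) := by gcongr
  have h5 : 0 ≤ (d - R) ^ 2 * (2 * d + R) := by positivity
  have h6 : 0 ≤ d ^ 3 := by positivity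
  nlinarith

theorem norm_x_sub_le (hr : IsAcceleratedRun f M x₀ δ x v z T) (hM : 0 < M) {w : Vec n} {P : ℝ}
    {K : ℕ} (hP : ∀ j ≤ K, ‖v j - w‖ ≤ P) : ∀ k ≤ K, ‖x k - w‖ ≤ P := by
  intro k
  induction k with
  | zero =>
    intro h
    rw [hr.x_zero, ← hr.v_zero]; exact hP 0 h
  | succ k ih =>
    intro h
    rw [hr.x_succ]
    exact norm_contract_sub_le hM k (ih (by omega)) (hP _ h)

end IsAcceleratedRun

/-! ### Gradient bounds near a minimizer -/

theorem gradient_eq_zero_of_forall_le {f : Vec n → ℝ} {w : Vec n} (hw : ∀ y, f w ≤ f y) :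
    gradient f w = 0 := by
  have : IsLocalMin f w := Filter.Eventually.of_forall hw
  rw [gradient, this.fderiv_eq_zero, map_zero]

theorem norm_gradient_le_of_minimizer {f : Vec n → ℝ} {M : ℝ} (hM : 0 < M)
    (hf : HasLipschitzHessian f M) {w : Vec n} (hw : ∀ y, f w ≤ f y) (x₀ y : Vec n) {P : ℝ}
    (hx₀ : ‖x₀ - w‖ ≤ P) (hy : ‖y - w‖ ≤ P) :
    ‖gradient f y‖ ≤ (‖hess f x₀‖ + 2 * M * P) * P := by
  have hP : 0 ≤ P := (norm_nonneg _).trans hy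
  have h1 := norm_gradient_add_sub_le hf w (y - w)
  rw [add_sub_cancel, gradient_eq_zero_of_forall_le hw, sub_zero] at h1
  have h2 : ‖hess f w‖ ≤ ‖hess f x₀‖ + M * P := by
    have e : hess f w = hess f x₀ - (hess f x₀ - hess f w) := by abel
    have h3 : ‖hess f x₀ - hess f w‖ ≤ M * P := (hf.2 x₀ w).trans (by gcongr)
    rw [e]
    exact (norm_sub_le _ _).trans (by linarith)
  have h3 : ‖hess f w (y - w)‖ ≤ (‖hess f x₀‖ + M * P) * P :=
    ((hess f w).le_opNorm _).trans (by gcongr)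
  have h4 : M / 2 * ‖y - w‖ ^ 2 ≤ M / 2 * P ^ 2 := by gcongr
  have h5 := norm_sub_norm_le (gradient f y) (hess f w (y - w))
  have h6 : 0 ≤ M * P ^ 2 := by positivity
  nlinarith

/-! ### Total complexity -/

theorem log_one_add_le_log_one_add_cube {t : ℝ} (ht : 0 ≤ t) :
    Real.log (1 + t) ≤ Real.log 4 + Real.log (1 + t ^ 3 / 3) := by
  rw [← Real.log_mul (by norm_num) (by positivity)]
  refine Real.log_le_log (by positivity) ?_
  have : 0 ≤ (t - 1) ^ 2 * (t + 2) := by positivity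
  nlinarith

/-- At $v_k$ the Bregman part is stationary, leaving $a_{k+1}\nabla f$ at a point within $P$ of the
minimizer. Measured in the length scale $E$, all powers of $E$ and $M$ cancel. -/
theorem IsAcceleratedRun.log_initial_gradient_le {f : Vec n → ℝ} {M : ℝ} {x₀ : Vec n}
    {x v : ℕ → Vec n} {z : ℕ → ℕ → Vec n} {T : ℕ → ℕ} {E t η : ℝ} (hM : 0 < M) (hE : 0 < E)
    (hr : IsAcceleratedRun f M x₀ (1 / 100 * E ^ 2) x v z T) (hf : HasLipschitzHessian f M)
    {w : Vec n} (hw : ∀ y, f w ≤ f y) (ht : 0 ≤ t) (hη : 0 ≤ η)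
    (hηE : ‖hess f x₀‖ = M * E * η) {K : ℕ} {P : ℝ}
    (hP : ∀ j ≤ K, ‖v j - w‖ ≤ P) (hPE : P ≤ E * (4 * (1 + t))) (hK : (K : ℝ) ≤ 4 * (1 + t))
    {k : ℕ} (hk : k < K)
    (hpos : 0 < ‖gradient (aux f M x₀ k (x k) (v k)) (v k)‖) :
    Real.log (‖gradient (aux f M x₀ k (x k) (v k)) (v k)‖ / (1 / 100 * E ^ 2)) ≤
      Real.log 6400 + 4 * Real.log (1 + t) + Real.log (1 + η) := by
  have hgrad : gradient (aux f M x₀ k (x k) (v k)) (v k)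
      = aCoef M (k + 1) • gradient f (contract M k (x k) (v k)) := by
    rw [gradient_aux hf.1 hM, sub_self, add_zero]
  have hx := hr.norm_x_sub_le hM hP k hk.le
  have hv := hP k hk.le
  have h0 := hP 0 (Nat.zero_le _)
  rw [hr.v_zero] at h0
  have hP0 : 0 ≤ P := (norm_nonneg _).trans h0
  have h1 := norm_gradient_le_of_minimizer hM hf hw x₀ (contract M k (x k) (v k)) h0
    (norm_contract_sub_le hM k hx hv)
  have ha : aCoef M (k + 1) ≤ (4 * (1 + t)) ^ 2 / (9 * M) := by
    have : ((k + 1 : ℕ) : ℝ) ≤ 4 * (1 + t) := le_trans (by exact_mod_cast hk) hK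
    unfold aCoef
    gcongr
  have hbound : ‖gradient (aux f M x₀ k (x k) (v k)) (v k)‖ / (1 / 100 * E ^ 2)
      ≤ 6400 * (1 + t) ^ 4 * (1 + η) := by
    rw [div_le_iff₀ (by positivity), hgrad, norm_smul, Real.norm_of_nonneg (aCoef_nonneg hM _)]
    rw [hηE] at h1
    calc _ ≤ (4 * (1 + t)) ^ 2 / (9 * M) * ((M * E * η + 2 * M * (E * (4 * (1 + t))))
            * (E * (4 * (1 + t)))) := by
          gcongr
          exact h1.trans (by gcongr)
      _ = 64 / 9 * E ^ 2 * ((1 + t) ^ 3 * (η + 8 * (1 + t))) := by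
          field_simp; ring
      _ ≤ 64 / 9 * E ^ 2 * ((1 + t) ^ 3 * (8 * (1 + t) * (1 + η))) := by
          gcongr; nlinarith [mul_nonneg ht hη]
      _ ≤ 64 * E ^ 2 * ((1 + t) ^ 3 * ((1 + t) * (1 + η))) := by
          have : 0 ≤ E ^ 2 * ((1 + t) ^ 3 * ((1 + t) * (1 + η))) := by positivity
          nlinarith
      _ = _ := by ring
  calc _ ≤ Real.log (6400 * (1 + t) ^ 4 * (1 + η)) := Real.log_le_log (by positivity) hbound
    _ = _ := by
      rw [Real.log_mul (by positivity) (by positivity),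
        Real.log_mul (by positivity) (by positivity), Real.log_pow]
      norm_num

theorem rpow_one_third_pow {a : ℝ} (ha : 0 ≤ a) : (a ^ (1 / 3 : ℝ)) ^ 3 = a := by
  rw [← Real.rpow_natCast, ← Real.rpow_mul ha]; norm_num

theorem exists_total_iteration_bound : ∃ C : ℝ, 0 < C ∧ ∀ (n : ℕ) (f : Vec n → ℝ) (M : ℝ)
    (x₀ w : Vec n) (E t η : ℝ), 0 < M → 0 < E → HasLipschitzHessian f M →
    ConvexOn ℝ univ f → (∀ y, f w ≤ f y) → ‖x₀ - w‖ = E * t → ‖hess f x₀‖ = M * E * η →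
    ∀ (x v : ℕ → Vec n) (z : ℕ → ℕ → Vec n) (T : ℕ → ℕ),
      IsAcceleratedRun f M x₀ (1 / 100 * E ^ 2) x v z T →
      ∃ K : ℕ, f (x K) - f w ≤ M * E ^ 3 ∧
        ((∑ k ∈ Finset.range K, (T k + 1) : ℕ) : ℝ) ≤
          C * (1 + t) * (1 + Real.log (1 + t ^ 3 / 3) + Real.log (1 + η ^ 3)) := by
  obtain ⟨C, hC0, hC⟩ := exists_inner_iteration_bound
  set D : ℝ := Real.log 6400 + 5 * Real.log 4 + 5
  have hl1 : 0 < Real.log 6400 := Real.log_pos (by norm_num)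
  have hl2 : 0 < Real.log 4 := Real.log_pos (by norm_num)
  refine ⟨4 * (2 + C * D), by positivity, ?_⟩
  intro n f M x₀ w E t η hM hE hf hc hw hR hη x v z T hr
  have ht : 0 ≤ t := by
    have := norm_nonneg (x₀ - w); rw [hR] at this; exact nonneg_of_mul_nonneg_right this hE
  have hη0 : 0 ≤ η := by
    have := norm_nonneg (hess f x₀); rw [hη] at this
    exact nonneg_of_mul_nonneg_right this (by positivity)
  set K : ℕ := ⌈4 * t⌉₊ + 1 with hKdef
  have hK1 : 4 * t ≤ K := by
    rw [hKdef]; push_cast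
    have := Nat.le_ceil (4 * t); linarith
  have hK2 : (K : ℝ) ≤ 4 * t + 2 := by
    rw [hKdef]; push_cast
    have := Nat.ceil_lt_add_one (show 0 ≤ 4 * t by positivity); linarith
  have hK3 : (1 : ℝ) ≤ K := by rw [hKdef]; push_cast; linarith [Nat.cast_nonneg (α := ℝ) ⌈4 * t⌉₊]
  -- As $K\ge1$, $\delta K\le(EK/10)^2$. With $4t\le K$ the gap bound closes because
  -- $\frac1{64}+\frac1{200}\le\frac1{27}$.
  obtain ⟨P, hP, hPle, hgap⟩ := hr.exists_radius hM (by positivity) hf.1 hc hw K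
    (d := E * K / 10) (by positivity) (by
      have : (K : ℝ) ≤ K ^ 2 := by nlinarith
      calc 1 / 100 * E ^ 2 * (K : ℝ) ≤ 1 / 100 * E ^ 2 * (K : ℝ) ^ 2 := by gcongr
        _ = _ := by ring)
  rw [hR] at hPle hgap
  have hPE : P ≤ E * (4 * (1 + t)) := by nlinarith
  refine ⟨K, ?_, ?_⟩
  · have hA := le_ACoef hM K
    have h0 : 0 ≤ f (x K) - f w := sub_nonneg.2 (hw _)
    have h1 : (K : ℝ) ^ 3 / (27 * M) * (f (x K) - f w) ≤ (E * t) ^ 3 + 5 * (E * K / 10) ^ 3 :=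
      le_trans (by gcongr) hgap
    have h2 : (4 * t) ^ 3 ≤ (K : ℝ) ^ 3 := by gcongr
    have h3 : (E * t) ^ 3 + 5 * (E * K / 10) ^ 3 ≤ (K : ℝ) ^ 3 / (27 * M) * (M * E ^ 3) := by
      have e : (K : ℝ) ^ 3 / (27 * M) * (M * E ^ 3) = E ^ 3 * ((K : ℝ) ^ 3 / 27) := by field_simp
      have e' : (E * t) ^ 3 + 5 * (E * K / 10) ^ 3 = E ^ 3 * (t ^ 3 + (K : ℝ) ^ 3 / 200) := by ring
      rw [e, e']
      gcongr
      have : 0 ≤ (K : ℝ) ^ 3 := by positivity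
      linarith
    exact le_of_mul_le_mul_left (h1.trans h3) (by positivity)
  · set L₁ := Real.log (1 + t ^ 3 / 3)
    set L₂ := Real.log (1 + η ^ 3)
    have hL₁ : 0 ≤ L₁ := Real.log_nonneg (le_add_of_nonneg_right (by positivity))
    have hL₂ : 0 ≤ L₂ := Real.log_nonneg (le_add_of_nonneg_right (by positivity))
    have hlt := log_one_add_le_log_one_add_cube ht
    have hlη : Real.log (1 + η) ≤ Real.log 4 + L₂ := by
      refine (log_one_add_le_log_one_add_cube hη0).trans
        (add_le_add le_rfl (Real.log_le_log (by positivity) ?_))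
      have : 0 ≤ η ^ 3 := by positivity
      linarith
    have hT : ∀ k < K, ((T k + 1 : ℕ) : ℝ) ≤ (2 + C * D) * (1 + L₁ + L₂) := by
      intro k hk
      have hCD : 0 ≤ C * D * (1 + L₁ + L₂) := by positivity
      -- For $T_k>0$ the gradients are large up to index $T_k-1$, hence the 2 in the constant: one
      -- lost index and one outer iteration.
      rcases Nat.eq_zero_or_pos (T k) with h0 | h0
      · rw [h0]; push_cast; nlinarith
      have hz0 : z k 0 = v k := (hr.inner_run k).1
      have hpos : 0 < ‖gradient (aux f M x₀ k (x k) (v k)) (v k)‖ := by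
        have := hr.inner_first k 0 h0
        rw [hz0] at this
        exact lt_trans (by positivity) this
      have hlog := hr.log_initial_gradient_le hM hE hf hw ht hη0 hη hP hPE (by linarith) hk hpos
      have hN := hC n _ (v k) (z k) (1 / 100 * E ^ 2) (by positivity)
        (hasLipschitzHessian_aux hM hf x₀ k (x k) (v k))
        (isCubicallyConvex_aux hM hf.1 hc x₀ k (x k) (v k)) (hr.inner_run k) (T k - 1)
        fun i hi => hr.inner_first k i (by omega)
      rw [Nat.cast_sub h0] at hN
      have h2 : 1 + Real.log (‖gradient (aux f M x₀ k (x k) (v k)) (v k)‖ / (1 / 100 * E ^ 2))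
          ≤ D * (1 + L₁ + L₂) := by
        have : 1 + (Real.log 6400 + 4 * (Real.log 4 + L₁) + (Real.log 4 + L₂))
            ≤ D * (1 + L₁ + L₂) := by
          simp only [D]
          nlinarith [mul_nonneg hl1.le hL₁, mul_nonneg hl1.le hL₂, mul_nonneg hl2.le hL₁,
            mul_nonneg hl2.le hL₂]
        linarith
      have h3 := mul_le_mul_of_nonneg_left h2 hC0.le
      push_cast at hN ⊢
      nlinarith
    have hΛ : 0 ≤ (2 + C * D) * (1 + L₁ + L₂) := by positivity
    push_cast at hT ⊢
    calc _ ≤ ∑ k ∈ Finset.range K, (2 + C * D) * (1 + L₁ + L₂) :=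
          Finset.sum_le_sum fun k hk => hT k (Finset.mem_range.1 hk)
      _ = K * ((2 + C * D) * (1 + L₁ + L₂)) := by simp
      _ ≤ (4 * (1 + t)) * ((2 + C * D) * (1 + L₁ + L₂)) := by gcongr; linarith
      _ = _ := by ring

end UTR

/-! ### The complexity bound in the original parameters -/

theorem mainTheorem5 :
    ∃ c C : ℝ, 0 < c ∧ 0 < C ∧
      ∀ (n : ℕ) (f : UTR.Vec n → ℝ) (M : ℝ) (x₀ xstar : UTR.Vec n) (ε : ℝ),
        0 < M → UTR.HasLipschitzHessian f M → ConvexOn ℝ Set.univ f →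
        (∀ y, f xstar ≤ f y) → 0 < ε →
        (∃ (x v : ℕ → UTR.Vec n) (z : ℕ → ℕ → UTR.Vec n) (T : ℕ → ℕ),
          UTR.IsAcceleratedRun f M x₀ (c * (ε / M) ^ (2 / 3 : ℝ)) x v z T) ∧
        ∀ (x v : ℕ → UTR.Vec n) (z : ℕ → ℕ → UTR.Vec n) (T : ℕ → ℕ),
          UTR.IsAcceleratedRun f M x₀ (c * (ε / M) ^ (2 / 3 : ℝ)) x v z T →
          (∀ k, UTR.HasLipschitzHessian (UTR.aux f M x₀ k (x k) (v k)) UTR.auxLip) ∧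
          ∃ K : ℕ, f (x K) - f xstar ≤ ε ∧
            ((∑ k ∈ Finset.range K, (T k + 1) : ℕ) : ℝ) ≤
              C * (1 + (M * UTR.bregman x₀ x₀ xstar) ^ (1 / 3 : ℝ) * ε ^ (-(1 / 3) : ℝ)) *
                (1 + Real.log (1 + M * UTR.bregman x₀ x₀ xstar / ε) +
                  Real.log (1 + ‖UTR.hess f x₀‖ ^ 3 / (M ^ 2 * ε))) := by
  obtain ⟨C, hC0, hC⟩ := UTR.exists_total_iteration_bound
  refine ⟨1 / 100, 2 * C, by norm_num, by positivity, ?_⟩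
  intro n f M x₀ w ε hM hf hc hw hε
  refine ⟨UTR.exists_isAcceleratedRun hM hf hc x₀ (by positivity), ?_⟩
  intro x v z T hr
  refine ⟨fun k => UTR.hasLipschitzHessian_aux hM hf x₀ k (x k) (v k), ?_⟩
  -- The natural length scale: $ME^3=\varepsilon$, and $\delta$ is $E^2/100$.
  set E : ℝ := (ε / M) ^ (1 / 3 : ℝ) with hEdef
  have hE : 0 < E := by positivity
  have hE3 : E ^ 3 = ε / M := UTR.rpow_one_third_pow (by positivity)
  have hE2 : (ε / M) ^ (2 / 3 : ℝ) = E ^ 2 := by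
    rw [hEdef, ← Real.rpow_natCast, ← Real.rpow_mul (by positivity)]; norm_num
  have hME3 : M * E ^ 3 = ε := by rw [hE3]; field_simp
  rw [hE2] at hr
  set t := ‖x₀ - w‖ / E with ht
  set η := ‖UTR.hess f x₀‖ / (M * E) with hη
  have ht0 : 0 ≤ t := by positivity
  obtain ⟨K, hgap, hsum⟩ := hC n f M x₀ w E t η hM hE hf hc hw
    (by rw [ht]; field_simp) (by rw [hη]; field_simp) x v z T hr
  refine ⟨K, hgap.trans_eq hME3, hsum.trans ?_⟩
  have hb : M * UTR.bregman x₀ x₀ w / ε = t ^ 3 / 3 := by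
    rw [UTR.bregman_self_left, norm_sub_rev, ht, ← hME3]; field_simp
  have hh : ‖UTR.hess f x₀‖ ^ 3 / (M ^ 2 * ε) = η ^ 3 := by
    rw [hη, ← hME3]; field_simp
  have hMb : 0 ≤ M * UTR.bregman x₀ x₀ w := by
    rw [UTR.bregman_self_left]; positivity
  -- The cube of the bracket is $t^3/3$, and $2^3/3\ge1$.
  have hτ : t ≤ 2 * ((M * UTR.bregman x₀ x₀ w) ^ (1 / 3 : ℝ) * ε ^ (-(1 / 3) : ℝ)) := by
    rw [Real.rpow_neg hε.le, ← div_eq_mul_inv, ← Real.div_rpow hMb hε.le, hb]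
    refine le_of_pow_le_pow_left₀ (n := 3) (by norm_num) (by positivity) ?_
    rw [mul_pow, UTR.rpow_one_third_pow (by positivity)]
    have : 0 ≤ t ^ 3 := by positivity
    linarith
  rw [hb, hh]
  have hl1 : 0 ≤ Real.log (1 + t ^ 3 / 3) :=
    Real.log_nonneg (le_add_of_nonneg_right (by positivity))
  have hl2 : 0 ≤ Real.log (1 + η ^ 3) := Real.log_nonneg (le_add_of_nonneg_right (by positivity))
  rw [show 2 * C * (1 + (M * UTR.bregman x₀ x₀ w) ^ (1 / 3 : ℝ) * ε ^ (-(1 / 3) : ℝ))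
    = C * (2 + 2 * ((M * UTR.bregman x₀ x₀ w) ^ (1 / 3 : ℝ) * ε ^ (-(1 / 3) : ℝ))) by ring]
  gcongr
  linarith
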